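/- Let $P$ be a bounded graded poset with minimum $\hat 0$ and maximum $\hat 1$: $P$ has both, and for all $x\le y$ there is an $n\in\mathbb{N}$ such that all maximal chains of the interval $P(x,y)=\{z : x\le z\le y\}$ have exactly $n+1$ elements ($n$ is the rank of $P(x,y)$; every chain of it then lies in a maximal one). The orthoscheme complex $|P|$ is the order complex of $P$ (simplices are the nonempty finite chains, $v_x$ is the vertex of $x\in P$, and $e_{xy}$ is the edge of $x<y$), made into a piecewise Euclidean complex by giving the simplex of each maximal chain $y_0<\dots<y_n$ the metric of the standard orthoscheme with vertices $v_{y_j}=e_1+\dots+e_j\in\mathbb{R}^n$. For a face $\tau$ of a Euclidean polytope $\rho$, the link $\mathrm{lk}(\tau,\rho)$ is the spherical polytope of unit vectors $u$ perpendicular to the affine hull of $\tau$ such that for every $y$ in the relative interior of $\tau$ there is an $\varepsilon>0$ with $y+\varepsilon u\in\rho$. For a cell $\tau$ of a piecewise Euclidean complex $K$, the link $\mathrm{lk}(\tau,K)$ is the piecewise spherical complex obtained by gluing the polytopes $\mathrm{lk}(\tau,\rho)$ over all cells $\rho$ of $K$ that have $\tau$ as a face. The spherical join $*$ of piecewise spherical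 complexes has as cells the spherical joins of cells of the factors (empty cells included); the join of spherical polytopes $A_1,\dots,A_m$ consists of the unit vectors $(w_1,\dots,w_m)$ of the orthogonal direct sum such that each nonzero $w_i$ is a positive multiple of a point of $A_i$. Let $x_0<x_1<\dots<x_k$ $(k\ge 0)$ be a chain in $P$ and let $\sigma$ be the corresponding simplex of $|P|$. Then $$\mathrm{lk}(\sigma,|P|)\;\cong\;K_{\hat 0} * L_1 * \cdots * L_k * K_{\hat 1},$$ where $K_{\hat 0}=\mathrm{lk}(v_{x_0},|P(\hat 0,x_0)|)$ and $K_{\hat 1}=\mathrm{lk}(v_{x_k},|P(x_k,\hat 1)|)$ are local endpoint links, and $L_i=\mathrm{lk}(e_{x_{i-1}x_i},|P(x_{i-1},x_i)|)$, $1\le i\le k$, are local diagonal links. Here $\cong$ means isometric as piecewise spherical complexes: there is a bijection of the underlying spaces that preserves the intrinsic length distances, maps every cell isometrically (for the spherical distance) onto a cell, and induces an isomorphism of the posets of cells. -/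

import Mathlib

universe u

/-! ### Graded posets -/

/-- A poset has rank `n` if it is bounded, every chain is contained in a maximal chain, and every
maximal chain has length `n`, that is, has `n + 1` elements. -/
def HasRank (P : Type*) [PartialOrder P] (n : ℕ) : Prop :=
  (∃ a : P, IsBot a) ∧ (∃ b : P, IsTop b) ∧
    (∀ c : Set P, IsChain (· ≤ ·) c → ∃ m : Set P, IsMaxChain (· ≤ ·) m ∧ c ⊆ m) ∧
    ∀ m : Set P, IsMaxChain (· ≤ ·) m → m.encard = n + 1

/-- A poset is graded if each of its intervals has a rank. -/
def IsGraded (P : Type*) [PartialOrder P] : Prop :=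
  ∀ x y : P, x ≤ y → ∃ n : ℕ, HasRank (Set.Icc x y) n

theorem HasRank.congr {P Q : Type*} [PartialOrder P] [PartialOrder Q] (e : P ≃o Q) {n : ℕ}
    (h : HasRank P n) : HasRank Q n := by
  obtain ⟨⟨a, ha⟩, ⟨b, hb⟩, -, h4⟩ := h
  refine ⟨⟨e a, fun q => ?_⟩, ⟨e b, fun q => ?_⟩, fun c hc => hc.exists_maxChain, fun m hm => ?_⟩
  · simpa using e.monotone (ha (e.symm q))
  · simpa using e.monotone (hb (e.symm q))
  · rw [← h4 _ (hm.image e.symm), e.symm.injective.encard_image]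

/-- An interval of an interval is an interval. -/
def iccIccIso {P : Type*} [PartialOrder P] {a b : P} (x y : Set.Icc a b) :
    Set.Icc (x : P) (y : P) ≃o Set.Icc x y where
  toFun z := ⟨⟨z, x.2.1.trans z.2.1, z.2.2.trans y.2.2⟩, z.2⟩
  invFun z := ⟨z.1.1, z.2⟩
  left_inv _ := rfl
  right_inv _ := rfl
  map_rel_iff' := Iff.rfl

theorem IsGraded.interval {P : Type*} [PartialOrder P] (hP : IsGraded P) (a b : P) :
    IsGraded (Set.Icc a b) := fun x y hxy =>
  (hP x y hxy).imp fun _ h => h.congr (iccIccIso x y)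

/-- The rank of an element `x` of a graded poset with a minimum: the rank of `[⊥, x]`. -/
noncomputable def IsGraded.rank {P : Type*} [PartialOrder P] [OrderBot P] (hP : IsGraded P)
    (x : P) : ℕ :=
  (hP ⊥ x bot_le).choose

theorem IsGraded.rank_strictMono {P : Type*} [PartialOrder P] [OrderBot P] (hP : IsGraded P) :
    StrictMono hP.rank := by
  intro x y hxy
  obtain ⟨-, -, ex, hx⟩ := (hP ⊥ x bot_le).choose_spec
  obtain ⟨-, -, ey, hy⟩ := (hP ⊥ y bot_le).choose_spec
  obtain ⟨m, hm, -⟩ := ex ∅ IsChain.empty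
  let f : Set.Icc ⊥ x → Set.Icc ⊥ y := fun z => ⟨z, z.2.1, z.2.2.trans hxy.le⟩
  have hf : Function.Injective f := fun a b h => Subtype.ext (congrArg (fun z => z.1) h)
  let t : Set.Icc ⊥ y := ⟨y, bot_le, le_rfl⟩
  have ht : t ∉ f '' m := by
    rintro ⟨z, -, hz⟩
    have : (z : P) = y := congrArg Subtype.val hz
    exact hxy.not_ge (this ▸ z.2.2)
  have hc : IsChain (· ≤ ·) (insert t (f '' m)) := by
    refine IsChain.insert ?_ fun b _ _ => Or.inr b.2.2
    rintro _ ⟨a, ha, rfl⟩ _ ⟨b, hb, rfl⟩ -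
    exact hm.1.total ha hb
  obtain ⟨m', hm', hsub⟩ := ey _ hc
  have h1 := Set.encard_le_encard hsub
  rw [Set.encard_insert_of_notMem ht, hf.encard_image, hx m hm, hy m' hm'] at h1
  change (hP ⊥ x bot_le).choose < (hP ⊥ y bot_le).choose
  have h2 : (hP ⊥ x bot_le).choose + 1 + 1 ≤ (hP ⊥ y bot_le).choose + 1 := by exact_mod_cast h1
  omega

/-! ### Euclidean and spherical polytopes -/

section Polytopes

set_option linter.unusedSectionVars false

variable {E F : Type*} [NormedAddCommGroup E] [InnerProductSpace ℝ E] [FiniteDimensional ℝ E]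
  [NormedAddCommGroup F] [InnerProductSpace ℝ F] [FiniteDimensional ℝ F]

/-- A nonempty Euclidean polytope: the convex hull of a nonempty finite set. -/
def IsEuclideanPolytope {E : Type*} [NormedAddCommGroup E] [InnerProductSpace ℝ E]
    (S : Set E) : Prop :=
  ∃ V : Set E, V.Finite ∧ V.Nonempty ∧ S = convexHull ℝ V

/-- A (possibly empty) spherical polytope: the spherical convex hull of a finite set (the set of
unit vectors in the convex cone generated by it) that is contained in an open hemisphere. -/
def IsSphericalPolytope {E : Type*} [NormedAddCommGroup E] [InnerProductSpace ℝ E]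
    (S : Set E) : Prop :=
  (∃ V : Set E, V.Finite ∧ S = {u | ‖u‖ = 1 ∧ u ∈ PointedCone.hull ℝ V}) ∧
    ∃ l : E →L[ℝ] ℝ, ∀ u ∈ S, 0 < l u

/-- `B` is a face of the spherical polytope `A`: it is cut out by the boundary of a closed
hemisphere that contains `A`, or (when the functional vanishes on `A`) it is `A`. -/
def IsSphericalFace {E : Type*} [NormedAddCommGroup E] [InnerProductSpace ℝ E]
    (A B : Set E) : Prop :=
  ∃ l : E →L[ℝ] ℝ, (∀ u ∈ A, l u ≤ 0) ∧ B = {u ∈ A | l u = 0}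

/-- The link of the face `T` in the polytope `S`: the unit vectors `u` perpendicular to the affine
hull of `T` such that, for every `x` in the (relative) interior of `T`, the point `x + ε u` is in
`S` for some `ε > 0`. -/
def faceLink {E : Type*} [NormedAddCommGroup E] [InnerProductSpace ℝ E] (T S : Set E) : Set E :=
  {u | ‖u‖ = 1 ∧ u ∈ (affineSpan ℝ T).directionᗮ ∧
    ∀ x ∈ intrinsicInterior ℝ T, ∃ ε : ℝ, 0 < ε ∧ x + ε • u ∈ S}

theorem convexHull_inter_max {V : Set E} {l : E →L[ℝ] ℝ} {M : ℝ} (hV : ∀ v ∈ V, l v ≤ M) :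
    {x ∈ convexHull ℝ V | l x = M} = convexHull ℝ {v ∈ V | l v = M} := by
  apply Set.Subset.antisymm
  · have key : convexHull ℝ V ⊆
        {x | l x ≤ M ∧ (l x = M → x ∈ convexHull ℝ {v ∈ V | l v = M})} := by
      refine convexHull_min ?_ ?_
      · exact fun v hv => ⟨hV v hv, fun h => subset_convexHull ℝ _ ⟨hv, h⟩⟩
      · rw [convex_iff_forall_pos]
        rintro x ⟨hx, hx'⟩ y ⟨hy, hy'⟩ a b ha hb hab
        have hle : a * l x + b * l y ≤ M := by
          have : M = a * M + b * M := by rw [← add_mul, hab, one_mul]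
          nlinarith
        refine ⟨by simpa using hle, fun h => ?_⟩
        have h' : a * l x + b * l y = M := by simpa using h
        have e : M = a * M + b * M := by rw [← add_mul, hab, one_mul]
        have h1 : l x = M := by
          by_contra hne
          have := mul_lt_mul_of_pos_left (lt_of_le_of_ne hx hne) ha
          have := mul_le_mul_of_nonneg_left hy hb.le
          linarith
        have h2 : l y = M := by
          by_contra hne
          have := mul_lt_mul_of_pos_left (lt_of_le_of_ne hy hne) hb
          have := mul_le_mul_of_nonneg_left hx ha.le
          linarith
        exact (convex_convexHull ℝ _) (hx' h1) (hy' h2) ha.le hb.le hab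
    exact fun x hx => (key hx.1).2 hx.2
  · refine convexHull_min (fun v hv => ⟨subset_convexHull ℝ _ hv.1, hv.2⟩) ?_
    refine (convex_convexHull ℝ V).inter ?_
    exact convex_hyperplane (l : E →ₗ[ℝ] ℝ).isLinear M

theorem exists_add_mem_of_mem_intrinsicInterior {T : Set E} {x w : E}
    (hx : x ∈ intrinsicInterior ℝ T) (hw : w ∈ (affineSpan ℝ T).direction) :
    ∃ δ : ℝ, 0 < δ ∧ x + δ • w ∈ T := by
  obtain ⟨y, hy, rfl⟩ := mem_intrinsicInterior.1 hx
  let f : ℝ → affineSpan ℝ T := fun t =>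
    ⟨(t • w) +ᵥ (y : E), AffineSubspace.vadd_mem_of_mem_direction
      (Submodule.smul_mem _ t hw) y.2⟩
  have hf : Continuous f := by
    refine Continuous.subtype_mk ?_ _
    simp only [vadd_eq_add]
    fun_prop
  have h0 : f 0 = y := Subtype.ext (by simp [f])
  have hn : f ⁻¹' interior ((↑) ⁻¹' T : Set (affineSpan ℝ T)) ∈ nhds (0 : ℝ) :=
    hf.continuousAt.preimage_mem_nhds (by rw [h0]; exact isOpen_interior.mem_nhds hy)
  obtain ⟨δ, hδ, hball⟩ := Metric.mem_nhds_iff.1 hn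
  refine ⟨δ / 2, by positivity, ?_⟩
  have : δ / 2 ∈ Metric.ball (0 : ℝ) δ := by
    rw [Metric.mem_ball, dist_zero_right, Real.norm_of_nonneg (by positivity)]; linarith
  have h := interior_subset (hball this)
  simpa [f, add_comm] using h

/-- The component of `y` perpendicular to the affine hull of `T`. -/
noncomputable def perp (T : Set E) : E →L[ℝ] E := (affineSpan ℝ T).directionᗮ.starProjection

theorem perp_mem (T : Set E) (y : E) : perp T y ∈ (affineSpan ℝ T).directionᗮ :=
  Submodule.starProjection_apply_mem _ _

theorem sub_perp_mem (T : Set E) (y : E) : y - perp T y ∈ (affineSpan ℝ T).direction := by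
  have := (affineSpan ℝ T).direction.starProjection_add_starProjection_orthogonal y
  rw [perp, sub_eq_of_eq_add this.symm]
  exact Submodule.starProjection_apply_mem _ _

theorem perp_eq_zero {T : Set E} {y : E} (hy : y ∈ (affineSpan ℝ T).direction) :
    perp T y = 0 := Submodule.starProjection_orthogonal_apply_eq_zero hy

theorem perp_eq_self {T : Set E} {y : E} (hy : y ∈ (affineSpan ℝ T).directionᗮ) :
    perp T y = y := Submodule.starProjection_eq_self_iff.2 hy

theorem sub_mem_direction {T : Set E} {x y : E} (hx : x ∈ T) (hy : y ∈ T) :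
    y - x ∈ (affineSpan ℝ T).direction :=
  AffineSubspace.vsub_mem_direction (mem_affineSpan ℝ hy) (mem_affineSpan ℝ hx)

/-- Directions at `x` pointing into `S` form a cone. -/
def dirCone (S : Set E) (hS : Convex ℝ S) (x : E) (hx : x ∈ S) : PointedCone ℝ E :=
  PointedCone.ofConeComb {u | ∃ ε : ℝ, 0 < ε ∧ x + ε • u ∈ S} ⟨0, 1, one_pos, by simpa using hx⟩ (by
    rintro u ⟨ε, hε, hu⟩ v ⟨δ, hδ, hv⟩ a ha b hb
    refine ⟨1 / (a / ε + b / δ + 1), by positivity, ?_⟩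
    have hs : 0 < a / ε + b / δ + 1 := by positivity
    have h := hS.sum_mem (t := Finset.univ)
      (w := ![a / ε / (a / ε + b / δ + 1), b / δ / (a / ε + b / δ + 1), 1 / (a / ε + b / δ + 1)])
      (z := ![x + ε • u, x + δ • v, x])
      (by intro i _; fin_cases i <;> simp <;> positivity)
      (by simp [Fin.sum_univ_three]; field_simp)
      (by intro i _; fin_cases i <;> simp [hu, hv, hx])
    convert h using 1
    simp only [Fin.sum_univ_three, Matrix.cons_val_zero, Matrix.cons_val_one, Matrix.cons_val]
    match_scalars <;> field_simp)

theorem mem_dirCone {S : Set E} {hS : Convex ℝ S} {x : E} {hx : x ∈ S} {u : E} :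
    u ∈ dirCone S hS x hx ↔ ∃ ε : ℝ, 0 < ε ∧ x + ε • u ∈ S := Iff.rfl

theorem perp_sub_mem_dirCone {T S : Set E} (hS : Convex ℝ S) (hTS : T ⊆ S) {x y : E}
    (hx : x ∈ intrinsicInterior ℝ T) (hy : y ∈ S) :
    perp T (y - x) ∈ dirCone S hS x (hTS (intrinsicInterior_subset hx)) := by
  have hxT := intrinsicInterior_subset hx
  obtain ⟨δ, hδ, hw⟩ := exists_add_mem_of_mem_intrinsicInterior hx
    (Submodule.neg_mem _ (sub_perp_mem T (y - x)))
  have h1 : y - x ∈ dirCone S hS x (hTS hxT) := mem_dirCone.2 ⟨1, one_pos, by simpa using hy⟩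
  have h2 : -(y - x - perp T (y - x)) ∈ dirCone S hS x (hTS hxT) :=
    mem_dirCone.2 ⟨δ, hδ, hTS hw⟩
  have := add_mem h1 h2
  simpa using this

theorem perp_sub_eq {T : Set E} {x x' : E} (hx : x ∈ T) (hx' : x' ∈ T) (y : E) :
    perp T (y - x) = perp T (y - x') := by
  have := perp_eq_zero (sub_mem_direction hx hx')
  rw [← sub_eq_zero, ← map_sub]
  simpa using this

/-- The normalised perpendicular component of a point of `S` is in the link. -/
theorem normalize_mem_faceLink {T S : Set E} (hS : Convex ℝ S) (hTS : T ⊆ S) {u : E}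
    (hu : u ∈ (affineSpan ℝ T).directionᗮ) (hu0 : u ≠ 0)
    (h : ∀ x (hx : x ∈ intrinsicInterior ℝ T),
      u ∈ dirCone S hS x (hTS (intrinsicInterior_subset hx))) :
    ‖u‖⁻¹ • u ∈ faceLink T S := by
  refine ⟨norm_smul_inv_norm (𝕜 := ℝ) hu0, Submodule.smul_mem _ _ hu, fun x hx => ?_⟩
  exact mem_dirCone.1 (PointedCone.smul_mem _ (inv_nonneg.2 (norm_nonneg u)) (h x hx))

theorem faceLink_eq {T S : Set E} (hS : Convex ℝ S) (hTS : T ⊆ S) {V : Set E}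
    (hV : S = convexHull ℝ V) {x : E} (hx : x ∈ intrinsicInterior ℝ T) :
    faceLink T S = {u | ‖u‖ = 1 ∧ u ∈ PointedCone.hull ℝ ((fun v => perp T (v - x)) '' V)} := by
  have hxT := intrinsicInterior_subset hx
  ext u
  constructor
  · rintro ⟨h1, h2, h3⟩
    refine ⟨h1, ?_⟩
    obtain ⟨ε, hε, hu⟩ := h3 x hx
    have key : S ⊆ {y | perp T (y - x) ∈ PointedCone.hull ℝ ((fun v => perp T (v - x)) '' V)} := by
      rw [hV]
      refine convexHull_min (fun v hv => PointedCone.subset_hull ⟨v, hv, rfl⟩) ?_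
      intro y hy z hz a b ha hb hab
      have e : perp T (a • y + b • z - x) = a • perp T (y - x) + b • perp T (z - x) := by
        rw [← map_smul, ← map_smul, ← map_add]
        congr 1
        have : x = a • x + b • x := by rw [← add_smul, hab, one_smul]
        nth_rw 1 [this]
        simp only [smul_sub]; abel
      change perp T (a • y + b • z - x) ∈
        PointedCone.hull ℝ ((fun v => perp T (v - x)) '' V)
      rw [e]
      exact add_mem (Submodule.smul_mem _ (⟨a, ha⟩ : {r : ℝ // 0 ≤ r}) hy)
        (Submodule.smul_mem _ (⟨b, hb⟩ : {r : ℝ // 0 ≤ r}) hz)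
    have h4 := key hu
    have e : perp T (x + ε • u - x) = ε • u := by
      rw [add_sub_cancel_left]; exact perp_eq_self (Submodule.smul_mem _ _ h2)
    rw [Set.mem_ofPred_eq, e] at h4
    have h5 := Submodule.smul_mem _ (⟨ε⁻¹, by positivity⟩ : {r : ℝ // 0 ≤ r}) h4
    have e2 : (⟨ε⁻¹, by positivity⟩ : {r : ℝ // 0 ≤ r}) • ε • u = u := by
      change ε⁻¹ • ε • u = u
      rw [smul_smul, inv_mul_cancel₀ hε.ne', one_smul]
    rwa [e2] at h5
  · rintro ⟨h1, h2⟩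
    refine ⟨h1, ?_, fun x' hx' => ?_⟩
    · have : PointedCone.hull ℝ ((fun v => perp T (v - x)) '' V) ≤
          ((affineSpan ℝ T).directionᗮ).restrictScalars {r : ℝ // 0 ≤ r} := by
        refine Submodule.span_le.2 ?_
        rintro _ ⟨v, -, rfl⟩
        exact perp_mem _ _
      exact this h2
    · have : PointedCone.hull ℝ ((fun v => perp T (v - x)) '' V) ≤
          dirCone S hS x' (hTS (intrinsicInterior_subset hx')) := by
        refine Submodule.span_le.2 ?_
        rintro _ ⟨v, hv, rfl⟩
        change perp T (v - x) ∈ _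
        rw [perp_sub_eq hxT (intrinsicInterior_subset hx')]
        exact perp_sub_mem_dirCone hS hTS hx' (hV ▸ subset_convexHull ℝ V hv)
      exact mem_dirCone.1 (this h2)

theorem apply_le_of_exposed {S T : Set E} {l : E →L[ℝ] ℝ}
    (hl : T = {x ∈ S | ∀ y ∈ S, l y ≤ l x}) {x y : E} (hx : x ∈ T) (hy : y ∈ S) :
    l y ≤ l x ∧ (l y = l x ↔ y ∈ T) := by
  rw [hl] at hx ⊢
  exact ⟨hx.2 y hy, fun h => ⟨hy, fun z hz => h ▸ hx.2 z hz⟩,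
    fun h => le_antisymm (hx.2 y hy) (h.2 x hx.1)⟩

theorem apply_direction_eq_zero {T : Set E} {l : E →L[ℝ] ℝ} {M : ℝ} (h : ∀ x ∈ T, l x = M)
    {w : E} (hw : w ∈ (affineSpan ℝ T).direction) : l w = 0 := by
  rw [direction_affineSpan] at hw
  have : vectorSpan ℝ T ≤ LinearMap.ker (l : E →ₗ[ℝ] ℝ) := by
    refine Submodule.span_le.2 ?_
    rintro _ ⟨a, ha, b, hb, rfl⟩
    simp [h a ha, h b hb]
  exact this hw

theorem isSphericalPolytope_faceLink {T S : Set E} (hS : IsEuclideanPolytope S)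
    (hT : T.Nonempty) (hTc : Convex ℝ T) (hTS : IsExposed ℝ S T) :
    IsSphericalPolytope (faceLink T S) := by
  obtain ⟨V, hVf, -, hV⟩ := hS
  have hSc : Convex ℝ S := hV ▸ convex_convexHull ℝ V
  obtain ⟨x, hx⟩ := hT.intrinsicInterior hTc
  have hxT := intrinsicInterior_subset hx
  refine ⟨⟨_, hVf.image _, faceLink_eq hSc hTS.subset hV hx⟩, ?_⟩
  obtain ⟨l, hl⟩ := hTS hT
  refine ⟨-l, ?_⟩
  rintro u ⟨h1, h2, h3⟩
  obtain ⟨ε, hε, hu⟩ := h3 x hx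
  obtain ⟨h4, h5⟩ := apply_le_of_exposed hl hxT hu
  rw [map_add, map_smul, smul_eq_mul] at h4 h5
  have h6 : l u ≠ 0 := by
    intro h0
    have hm : x + ε • u ∈ T := h5.1 (by simp [h0])
    have hd := sub_mem_direction hxT hm
    rw [add_sub_cancel_left] at hd
    have hd' : u ∈ (affineSpan ℝ T).direction := by
      have := Submodule.smul_mem _ ε⁻¹ hd
      rwa [smul_smul, inv_mul_cancel₀ hε.ne', one_smul] at this
    have : u = 0 := by
      have := (Submodule.mem_orthogonal _ _).1 h2 u hd'
      exact inner_self_eq_zero.1 this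
    simp [this] at h1
  have h7 : l u ≤ 0 := by nlinarith
  simpa using lt_of_le_of_ne h7 h6

/-- The link of `T` in a face `F` of `S` containing `T`. -/
theorem faceLink_exposed {T F S : Set E} {l : E →L[ℝ] ℝ}
    (hl : F = {x ∈ S | ∀ y ∈ S, l y ≤ l x}) (hTF : T ⊆ F) (hT : T.Nonempty) (hTc : Convex ℝ T) :
    (∀ u ∈ faceLink T S, l u ≤ 0) ∧ faceLink T F = {u ∈ faceLink T S | l u = 0} := by
  obtain ⟨x, hx⟩ := hT.intrinsicInterior hTc
  have hxT := intrinsicInterior_subset hx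
  refine ⟨fun u hu => ?_, ?_⟩
  · obtain ⟨ε, hε, h⟩ := hu.2.2 x hx
    have := (apply_le_of_exposed hl (hTF hxT) h).1
    rw [map_add, map_smul, smul_eq_mul] at this
    nlinarith
  · ext u
    constructor
    · rintro ⟨h1, h2, h3⟩
      refine ⟨⟨h1, h2, fun x hx => ?_⟩, ?_⟩
      · obtain ⟨ε, hε, h⟩ := h3 x hx
        rw [hl] at h
        exact ⟨ε, hε, h.1⟩
      · obtain ⟨ε, hε, h⟩ := h3 x hx
        have hS : x + ε • u ∈ S := by rw [hl] at h; exact h.1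
        have := (apply_le_of_exposed hl (hTF hxT) hS).2.2 h
        rw [map_add, map_smul, smul_eq_mul] at this
        have h' : ε * l u = 0 := by linarith
        exact (mul_eq_zero.1 h').resolve_left hε.ne'
    · rintro ⟨⟨h1, h2, h3⟩, h0⟩
      refine ⟨h1, h2, fun y hy => ?_⟩
      obtain ⟨ε, hε, h⟩ := h3 y hy
      refine ⟨ε, hε, (apply_le_of_exposed hl (hTF (intrinsicInterior_subset hy)) h).2.1 ?_⟩
      simp [h0]

/-- Every face of the link comes from a face of the polytope. -/
theorem exists_face_of_faceLink {T S : Set E} (hS : Convex ℝ S) (hTS : T ⊆ S) (hT : T.Nonempty)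
    (hTc : Convex ℝ T) {l : E →L[ℝ] ℝ} (hl : ∀ u ∈ faceLink T S, l u ≤ 0) :
    ∃ F, IsExposed ℝ S F ∧ T ⊆ F ∧ faceLink T F = {u ∈ faceLink T S | l u = 0} := by
  let l' : E →L[ℝ] ℝ := l.comp (perp T)
  have hl'T : ∀ x ∈ T, ∀ y ∈ S, l' y ≤ l' x := by
    intro x hx y hy
    have e : l' y - l' x = l (perp T (y - x)) := by simp [l']
    by_cases h0 : perp T (y - x) = 0
    · rw [h0, map_zero] at e; linarith
    · have hm := normalize_mem_faceLink hS hTS (perp_mem T (y - x)) h0 (fun z hz => by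
        rw [perp_sub_eq hx (intrinsicInterior_subset hz)]
        exact perp_sub_mem_dirCone hS hTS hz hy)
      have := hl _ hm
      rw [map_smul, smul_eq_mul] at this
      have hp : 0 < ‖perp T (y - x)‖⁻¹ := by positivity
      have : l (perp T (y - x)) ≤ 0 := by nlinarith
      linarith
  have hTF : T ⊆ {x ∈ S | ∀ y ∈ S, l' y ≤ l' x} := fun x hx => ⟨hTS hx, hl'T x hx⟩
  refine ⟨_, fun _ => ⟨l', rfl⟩, hTF, ?_⟩
  rw [(faceLink_exposed rfl hTF hT hTc).2]
  ext u
  refine and_congr_right fun hu => ?_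
  simp [l', perp_eq_self hu.2.1]

/-- A face is determined by its link. -/
theorem face_subset_of_faceLink_subset {T F F' S : Set E} (hF : IsExposed ℝ S F)
    (hF'c : Convex ℝ F') (hF'S : F' ⊆ S) (hTF : T ⊆ F) (hTF' : T ⊆ F') (hT : T.Nonempty)
    (hTc : Convex ℝ T) (h : faceLink T F' ⊆ faceLink T F) : F' ⊆ F := by
  obtain ⟨x, hx⟩ := hT.intrinsicInterior hTc
  have hxT := intrinsicInterior_subset hx
  obtain ⟨l, hl⟩ := hF ⟨x, hTF hxT⟩
  intro y hy
  have hlT : ∀ z ∈ T, l z = l x := fun z hz =>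
    (apply_le_of_exposed hl (hTF hxT) (hF'S (hTF' hz))).2.2 (hTF hz)
  have h0 : l (perp T (y - x)) = 0 := by
    by_cases h0 : perp T (y - x) = 0
    · simp [h0]
    · have hm := normalize_mem_faceLink hF'c hTF' (perp_mem T (y - x)) h0 (fun z hz => by
        rw [perp_sub_eq hxT (intrinsicInterior_subset hz)]
        exact perp_sub_mem_dirCone hF'c hTF' hz hy)
      have := h hm
      rw [(faceLink_exposed hl hTF hT hTc).2] at this
      have h2 := this.2
      rw [map_smul, smul_eq_mul] at h2
      exact (mul_eq_zero.1 h2).resolve_left (inv_ne_zero (norm_ne_zero_iff.2 h0))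
  have h1 := apply_direction_eq_zero hlT (sub_perp_mem T (y - x))
  rw [map_sub, map_sub, h0] at h1
  exact (apply_le_of_exposed hl (hTF hxT) (hF'S hy)).2.1 (by linarith)

theorem direction_affineSpan_image (g : E →ᵃⁱ[ℝ] F) (T : Set E) :
    (affineSpan ℝ (g '' T)).direction =
      (affineSpan ℝ T).direction.map (g.linearIsometry : E →ₗ[ℝ] F) := by
  have : affineSpan ℝ (g '' T) = (affineSpan ℝ T).map g.toAffineMap := by
    rw [AffineSubspace.map_span]; rfl
  rw [this, AffineSubspace.map_direction]; rfl

theorem faceLink_image (g : E →ᵃⁱ[ℝ] F) {T S : Set E} (hT : T.Nonempty) (hTc : Convex ℝ T) :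
    faceLink (g '' T) (g '' S) = g.linearIsometry '' faceLink T S := by
  have hg : ∀ (x u : E) (ε : ℝ), g x + ε • g.linearIsometry u = g (x + ε • u) := by
    intro x u ε
    have := g.map_vadd x (ε • u)
    simp only [vadd_eq_add, map_smul] at this
    rw [add_comm x, this, add_comm]
  ext w
  simp only [faceLink, Set.mem_ofPred_eq, Set.mem_image, AffineIsometry.intrinsicInterior_image,
    forall_exists_index, and_imp, forall_apply_eq_imp_iff₂, direction_affineSpan_image]
  constructor
  · rintro ⟨h1, h2, h3⟩
    obtain ⟨x, hx⟩ := hT.intrinsicInterior hTc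
    obtain ⟨ε, hε, y, hy, he⟩ := h3 x hx
    have hw : w = g.linearIsometry (ε⁻¹ • (y - x)) := by
      have h4 : g.linearIsometry (y - x) = g y - g x := g.map_vsub y x
      rw [map_smul, h4, he, add_sub_cancel_left, smul_smul, inv_mul_cancel₀ hε.ne', one_smul]
    refine ⟨_, ⟨?_, ?_, ?_⟩, hw.symm⟩
    · rw [← g.linearIsometry.norm_map, ← hw, h1]
    · rw [Submodule.mem_orthogonal] at h2 ⊢
      intro v hv
      rw [← g.linearIsometry.inner_map_map, ← hw]
      exact h2 _ (Submodule.mem_map_of_mem hv)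
    · intro z hz
      obtain ⟨δ, hδ, y', hy', he'⟩ := h3 z hz
      refine ⟨δ, hδ, ?_⟩
      rw [hw, hg] at he'
      rwa [← g.injective he']
  · rintro ⟨u, ⟨h1, h2, h3⟩, rfl⟩
    refine ⟨by rw [g.linearIsometry.norm_map, h1], ?_, ?_⟩
    · rw [Submodule.mem_orthogonal] at h2 ⊢
      rintro _ ⟨v, hv, rfl⟩
      exact (g.linearIsometry.inner_map_map v u).trans (h2 v hv)
    · intro x hx
      obtain ⟨ε, hε, h⟩ := h3 x hx
      exact ⟨ε, hε, _, h, (hg x u ε).symm⟩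

end Polytopes

/-! ### Piecewise Euclidean and piecewise spherical complexes -/

/-- A piecewise Euclidean complex: Euclidean polytopes glued together along faces by isometries.
It is presented by the poset of its (nonempty) cells; the polytope of a cell `c` lives in a
Euclidean space `E c`, and for `c ≤ d` the polytope of `c` is identified by an isometry with a face
of the polytope of `d`. Every face of a polytope is attained by exactly one cell, and two cells
that intersect do so in a common face. -/
structure PEComplex where
  Cell : Type u
  [order : PartialOrder Cell]
  E : Cell → Type
  [normed : ∀ c, NormedAddCommGroup (E c)]
  [innerProduct : ∀ c, InnerProductSpace ℝ (E c)]
  [finDim : ∀ c, FiniteDimensional ℝ (E c)]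
  polytope : ∀ c, Set (E c)
  isPolytope : ∀ c, IsEuclideanPolytope (polytope c)
  glue : ∀ {c d : Cell}, c ≤ d → (E c →ᵃⁱ[ℝ] E d)
  glue_refl : ∀ (c : Cell) (x : E c), glue (le_refl c) x = x
  glue_trans : ∀ {b c d : Cell} (h : b ≤ c) (h' : c ≤ d) (x : E b),
    glue h' (glue h x) = glue (h.trans h') x
  glue_face : ∀ {c d : Cell} (h : c ≤ d), IsExposed ℝ (polytope d) (glue h '' polytope c)
  exists_face : ∀ (d : Cell) (B : Set (E d)), IsExposed ℝ (polytope d) B → B.Nonempty →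
    ∃ (c : Cell) (h : c ≤ d), glue h '' polytope c = B
  face_unique : ∀ {c c' d : Cell} (h : c ≤ d) (h' : c' ≤ d),
    glue h '' polytope c = glue h' '' polytope c' → c = c'
  inter : ∀ b c d : Cell, b ≤ c → b ≤ d → ∃ g, IsGLB {c, d} g

attribute [instance] PEComplex.order PEComplex.normed PEComplex.innerProduct PEComplex.finDim

/-- A piecewise spherical complex: spherical polytopes glued together along faces by isometries,
presented by the poset of its cells. The shape of a cell `c` is a spherical polytope in the unit
sphere of `E c`, and the gluing isometries are restrictions of linear isometries. The empty face is
counted as a cell of every complex. -/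
structure PSComplex where
  Cell : Type u
  [order : PartialOrder Cell]
  E : Cell → Type
  [normed : ∀ c, NormedAddCommGroup (E c)]
  [innerProduct : ∀ c, InnerProductSpace ℝ (E c)]
  [finDim : ∀ c, FiniteDimensional ℝ (E c)]
  shape : ∀ c, Set (E c)
  isPolytope : ∀ c, IsSphericalPolytope (shape c)
  glue : ∀ {c d : Cell}, c ≤ d → (E c →ₗᵢ[ℝ] E d)
  glue_refl : ∀ (c : Cell) (x : E c), glue (le_refl c) x = x
  glue_trans : ∀ {b c d : Cell} (h : b ≤ c) (h' : c ≤ d) (x : E b),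
    glue h' (glue h x) = glue (h.trans h') x
  glue_face : ∀ {c d : Cell} (h : c ≤ d), IsSphericalFace (shape d) (glue h '' shape c)
  exists_face : ∀ (d : Cell) (B : Set (E d)), IsSphericalFace (shape d) B →
    ∃ (c : Cell) (h : c ≤ d), glue h '' shape c = B
  face_unique : ∀ {c c' d : Cell} (h : c ≤ d) (h' : c' ≤ d),
    glue h '' shape c = glue h' '' shape c' → c = c'
  inter : ∀ c d : Cell, ∃ g, IsGLB {c, d} g
  emptyCell : Cell
  shape_emptyCell : shape emptyCell = ∅
  emptyCell_le : ∀ c, emptyCell ≤ c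

attribute [instance] PSComplex.order PSComplex.normed PSComplex.innerProduct PSComplex.finDim

namespace PEComplex

theorem polytope_convex (K : PEComplex) (c : K.Cell) : Convex ℝ (K.polytope c) := by
  obtain ⟨V, -, -, hV⟩ := K.isPolytope c
  exact hV ▸ convex_convexHull ℝ V

theorem polytope_nonempty (K : PEComplex) (c : K.Cell) : (K.polytope c).Nonempty := by
  obtain ⟨V, -, hne, hV⟩ := K.isPolytope c
  exact hV ▸ hne.convexHull

theorem image_convex (K : PEComplex) {c d : K.Cell} (h : c ≤ d) :
    Convex ℝ (K.glue h '' K.polytope c) :=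
  (K.polytope_convex c).affine_image (K.glue h).toAffineMap

theorem image_image (K : PEComplex) {b c d : K.Cell} (h : b ≤ c) (h' : c ≤ d) :
    K.glue h' '' (K.glue h '' K.polytope b) = K.glue (h.trans h') '' K.polytope b := by
  rw [Set.image_image]
  exact Set.image_congr fun x _ => K.glue_trans h h' x

theorem image_subset (K : PEComplex) {b c d : K.Cell} (h : b ≤ c) (h' : c ≤ d) :
    K.glue (h.trans h') '' K.polytope b ⊆ K.glue h' '' K.polytope c := by
  rw [← K.image_image h h']
  exact Set.image_mono (K.glue_face h).subset

/-- If the face of `d` given by `b` is contained in the one given by `c`, then `b ≤ c`. -/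
theorem le_of_image_subset (K : PEComplex) {b c d : K.Cell} (h : b ≤ d) (h' : c ≤ d)
    (hs : K.glue h '' K.polytope b ⊆ K.glue h' '' K.polytope c) : b ≤ c := by
  obtain ⟨B, hB, hBe⟩ := Set.subset_image_iff.1 hs
  have hexp : IsExposed ℝ (K.polytope c) B := by
    rintro -
    obtain ⟨l, hl⟩ := ((K.glue_face h).mono (K.glue_face h').subset hs)
      ((K.polytope_nonempty b).image _)
    refine ⟨l.comp (K.glue h').linearIsometry.toContinuousLinearMap, ?_⟩
    have hlin : ∀ x y, l (K.glue h' x) - l (K.glue h' y) =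
        l ((K.glue h').linearIsometry x) - l ((K.glue h').linearIsometry y) := by
      intro x y
      have h1 : K.glue h' x - K.glue h' y = (K.glue h').linearIsometry (x - y) :=
        ((K.glue h').map_vsub x y).symm
      rw [← map_sub l, h1, map_sub, map_sub l]
    ext x
    have e1 : x ∈ B ↔ K.glue h' x ∈ K.glue h '' K.polytope b := by
      rw [← hBe, (K.glue h').injective.mem_set_image]
    rw [e1, hl, Set.mem_ofPred_eq, Set.mem_ofPred_eq, (K.glue h').injective.mem_set_image,
      Set.forall_mem_image]
    refine and_congr_right fun _ => forall₂_congr fun y _ => ?_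
    have := hlin y x
    simp only [ContinuousLinearMap.comp_apply, LinearIsometry.coe_toContinuousLinearMap]
    constructor <;> intro h <;> linarith
  have hBne : B.Nonempty := by
    rw [← Set.image_nonempty (f := K.glue h'), hBe]
    exact (K.polytope_nonempty b).image _
  obtain ⟨b', hb', he⟩ := K.exists_face c B hexp hBne
  have : b' = b := by
    apply K.face_unique (hb'.trans h') h
    rw [← K.image_image hb' h', he, hBe]
  exact this ▸ hb'

theorem faceLink_glue (K : PEComplex) {b c d : K.Cell} (h : b ≤ c) (h' : c ≤ d) :
    (K.glue h').linearIsometry '' faceLink (K.glue h '' K.polytope b) (K.polytope c) =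
      faceLink (K.glue (h.trans h') '' K.polytope b) (K.glue h' '' K.polytope c) := by
  rw [← faceLink_image _ ((K.polytope_nonempty b).image _) (K.image_convex h), K.image_image]

/-- The link of a cell `τ` of a piecewise Euclidean complex, obtained by gluing together the links
of `τ` in the polytopes that contain `τ` as a face. -/
noncomputable def link (K : PEComplex) (τ : K.Cell) : PSComplex where
  Cell := {σ : K.Cell // τ ≤ σ}
  E σ := K.E σ.1
  shape σ := faceLink (K.glue σ.2 '' K.polytope τ) (K.polytope σ.1)
  isPolytope σ := isSphericalPolytope_faceLink (K.isPolytope σ.1)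
    ((K.polytope_nonempty τ).image _) (K.image_convex σ.2) (K.glue_face σ.2)
  glue {c d} h := (K.glue (c := c.1) (d := d.1) h).linearIsometry
  glue_refl c x := by
    have h1 := (K.glue (le_refl c.1)).map_vsub x 0
    rw [K.glue_refl, K.glue_refl] at h1
    simpa using h1
  glue_trans {b c d} h h' x := by
    have h1 := (K.glue (c := b.1) (d := c.1) h).map_vsub x 0
    have h2 := (K.glue (c := c.1) (d := d.1) h').map_vsub (K.glue (c := b.1) (d := c.1) h x)
      (K.glue (c := b.1) (d := c.1) h 0)
    have h3 := (K.glue (c := b.1) (d := d.1) (h.trans h')).map_vsub x 0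
    rw [K.glue_trans, K.glue_trans, ← h3, ← h1] at h2
    simpa using h2
  glue_face {c d} h := by
    have hne := (K.polytope_nonempty τ).image (K.glue d.2)
    have hsub := K.image_subset c.2 (d := d.1) h
    obtain ⟨l, hl⟩ := K.glue_face (c := c.1) (d := d.1) h (hne.mono hsub)
    rw [K.faceLink_glue c.2 (d := d.1) h]
    obtain ⟨h1, h2⟩ := faceLink_exposed hl hsub hne (K.image_convex d.2)
    exact ⟨l, h1, h2⟩
  exists_face d B hB := by
    obtain ⟨l, hl, rfl⟩ := hB
    have hne := (K.polytope_nonempty τ).image (K.glue d.2)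
    obtain ⟨F, hF, hTF, he⟩ := exists_face_of_faceLink (K.polytope_convex d.1)
      (K.glue_face d.2).subset hne (K.image_convex d.2) hl
    obtain ⟨c, hc, rfl⟩ := K.exists_face d.1 F hF (hne.mono hTF)
    have hτc := K.le_of_image_subset d.2 hc hTF
    exact ⟨⟨c, hτc⟩, hc, (K.faceLink_glue hτc hc).trans he⟩
  face_unique {c c' d} h h' he := by
    have hne := (K.polytope_nonempty τ).image (K.glue d.2)
    rw [K.faceLink_glue c.2 (d := d.1) h, K.faceLink_glue c'.2 (d := d.1) h'] at he
    have hs := K.image_subset c.2 (d := d.1) h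
    have hs' := K.image_subset c'.2 (d := d.1) h'
    have hc := K.image_convex (c := c.1) (d := d.1) h
    have hc' := K.image_convex (c := c'.1) (d := d.1) h'
    have hf := K.glue_face (c := c.1) (d := d.1) h
    have hf' := K.glue_face (c := c'.1) (d := d.1) h'
    have hT := K.image_convex d.2
    exact Subtype.ext (K.face_unique (d := d.1) h h' (Set.Subset.antisymm
      (face_subset_of_faceLink_subset hf' hc hf.subset hs' hs hne hT he.le)
      (face_subset_of_faceLink_subset hf hc' hf'.subset hs hs' hne hT he.ge)))
  inter c d := by
    obtain ⟨g, hg⟩ := K.inter τ c.1 d.1 c.2 d.2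
    have hτg : τ ≤ g := hg.2 (by
      rintro _ (rfl | rfl)
      exacts [c.2, d.2])
    refine ⟨⟨g, hτg⟩, ?_, fun e he => hg.2 ?_⟩
    · rintro _ (rfl | rfl)
      exacts [hg.1 (Or.inl rfl), hg.1 (Or.inr rfl)]
    · rintro _ (rfl | rfl)
      exacts [he (Or.inl rfl), he (Or.inr rfl)]
  emptyCell := ⟨τ, le_rfl⟩
  shape_emptyCell := by
    have e : K.glue (le_refl τ) '' K.polytope τ = K.polytope τ := by
      simp [K.glue_refl]
    change faceLink (K.glue (le_refl τ) '' K.polytope τ) (K.polytope τ) = ∅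
    rw [e]
    refine Set.eq_empty_of_forall_notMem ?_
    rintro u ⟨h1, h2, h3⟩
    obtain ⟨x, hx⟩ := (K.polytope_nonempty τ).intrinsicInterior (K.polytope_convex τ)
    obtain ⟨ε, hε, h⟩ := h3 x hx
    have hd := Submodule.smul_mem _ ε⁻¹ (sub_mem_direction (intrinsicInterior_subset hx) h)
    rw [add_sub_cancel_left, smul_smul, inv_mul_cancel₀ hε.ne', one_smul] at hd
    have : u = 0 := inner_self_eq_zero.1 ((Submodule.mem_orthogonal _ _).1 h2 u hd)
    simp [this] at h1
  emptyCell_le c := c.2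

end PEComplex

/-! ### Spherical joins -/

section Join

set_option linter.unusedSectionVars false

variable {ι : Type*} [Fintype ι] {E F : ι → Type*}
  [∀ i, NormedAddCommGroup (E i)] [∀ i, InnerProductSpace ℝ (E i)]
  [∀ i, NormedAddCommGroup (F i)] [∀ i, InnerProductSpace ℝ (F i)]

/-- The spherical join of sets `S i` of unit vectors: the unit vectors of the orthogonal direct sum
of the `E i` each of whose nonzero components is a positive multiple of an element of `S i`.
For two factors these are the vectors `(cos θ • u, sin θ • v)` with `u ∈ S₁`, `v ∈ S₂` and
`0 ≤ θ ≤ π / 2` (the vector `u`, respectively `v`, is not needed when its coefficient is `0`). -/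
def joinShape (S : ∀ i, Set (E i)) : Set (PiLp 2 E) :=
  {w | ‖w‖ = 1 ∧ ∀ i, w i ≠ 0 → ‖w i‖⁻¹ • w i ∈ S i}

theorem hull_iff_normalize {E : Type*} [NormedAddCommGroup E] [InnerProductSpace ℝ E]
    (V : Set E) (x : E) :
    (x ≠ 0 → ‖x‖⁻¹ • x ∈ {u | ‖u‖ = 1 ∧ u ∈ PointedCone.hull ℝ V}) ↔
      x ∈ PointedCone.hull ℝ V := by
  constructor
  · intro h
    by_cases h0 : x = 0
    · rw [h0]; exact zero_mem _
    · have := PointedCone.smul_mem _ (norm_nonneg x) (h h0).2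
      rwa [smul_smul, mul_inv_cancel₀ (norm_ne_zero_iff.2 h0), one_smul] at this
  · exact fun h h0 => ⟨norm_smul_inv_norm (𝕜 := ℝ) h0,
      PointedCone.smul_mem _ (inv_nonneg.2 (norm_nonneg x)) h⟩

theorem single_smul' [DecidableEq ι] (i : ι) (r : ℝ) (u : E i) :
    PiLp.single 2 i (r • u) = r • PiLp.single 2 i u := by
  simp_rw [← PiLp.toLp_single, Pi.single_smul, WithLp.toLp_smul]

/-- The inclusion of a summand in an orthogonal direct sum. -/
noncomputable def singleLinear [DecidableEq ι] (i : ι) : E i →ₗ[ℝ] PiLp 2 E where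
  toFun u := PiLp.single 2 i u
  map_add' _ _ := PiLp.single_add 2 i
  map_smul' r u := single_smul' i r u

theorem sum_single_eq [DecidableEq ι] (w : PiLp 2 E) : ∑ i, PiLp.single 2 i (w i) = w := by
  ext j
  simp [Finset.sum_apply]

theorem single_mem_joinShape [DecidableEq ι] {S : ∀ i, Set (E i)} {i : ι} {u : E i}
    (hu : ‖u‖ = 1) : PiLp.single 2 i u ∈ joinShape S ↔ u ∈ S i := by
  have hu0 : u ≠ 0 := by rintro rfl; simp at hu
  constructor
  · intro h
    have := h.2 i (by simpa using hu0)
    simpa [hu] using this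
  · refine fun h => ⟨by simpa using hu, fun j hj => ?_⟩
    by_cases hij : j = i
    · subst hij; simpa [hu] using h
    · exact absurd (PiLp.single_eq_of_ne 2 hij u) hj

theorem isSphericalPolytope_joinShape {S : ∀ i, Set (E i)} (hS : ∀ i, IsSphericalPolytope (S i)) :
    IsSphericalPolytope (joinShape S) := by
  classical
  choose V hVf hV using fun i => (hS i).1
  choose l hl using fun i => (hS i).2
  refine ⟨⟨⋃ i, PiLp.single 2 i '' V i, Set.finite_iUnion fun i => (hVf i).image _, ?_⟩,
    ∑ i, (l i).comp (PiLp.proj 2 E i), ?_⟩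
  · ext w
    refine and_congr_right fun _ => ?_
    have e : (∀ i, w i ≠ 0 → ‖w i‖⁻¹ • w i ∈ S i) ↔ ∀ i, w i ∈ PointedCone.hull ℝ (V i) := by
      refine forall_congr' fun i => ?_
      rw [hV i, hull_iff_normalize]
    rw [e]
    constructor
    · intro h
      rw [← sum_single_eq w]
      refine sum_mem fun i _ => ?_
      have hle : PointedCone.hull ℝ (V i) ≤
          (PointedCone.hull ℝ (⋃ i, PiLp.single 2 i '' V i)).comap (singleLinear i) := by
        refine Submodule.span_le.2 fun v hv => ?_
        exact PointedCone.subset_hull (Set.mem_iUnion.2 ⟨i, v, hv, rfl⟩)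
      exact hle (h i)
    · intro h i
      have hle : PointedCone.hull ℝ (⋃ i, PiLp.single 2 i '' V i) ≤
          (PointedCone.hull ℝ (V i)).comap (PiLp.proj 2 E i : PiLp 2 E →L[ℝ] E i).toLinearMap := by
        refine Submodule.span_le.2 (Set.iUnion_subset fun j => ?_)
        rintro _ ⟨v, hv, rfl⟩
        change (PiLp.single 2 j v : PiLp 2 E) i ∈ PointedCone.hull ℝ (V i)
        by_cases hij : i = j
        · subst hij; simpa using PointedCone.subset_hull hv
        · rw [PiLp.single_eq_of_ne 2 hij]; exact zero_mem _
      exact hle h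
  · rintro w ⟨h1, h2⟩
    have hpos : ∀ i, w i ≠ 0 → 0 < l i (w i) := by
      intro i hi
      have := hl i _ (h2 i hi)
      rw [map_smul, smul_eq_mul] at this
      exact (mul_pos_iff_of_pos_left (by positivity)).1 this
    obtain ⟨j, hj⟩ : ∃ j, w j ≠ 0 := by
      by_contra! h
      have : w = 0 := by ext i; exact h i
      simp [this] at h1
    rw [_root_.sum_apply]
    refine Finset.sum_pos' (fun i _ => ?_) ⟨j, Finset.mem_univ j, hpos j hj⟩
    by_cases hi : w i = 0
    · simp [hi]
    · exact (hpos i hi).le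

theorem joinShape_face [DecidableEq ι] {S : ∀ i, Set (E i)}
    {l : PiLp 2 E →L[ℝ] ℝ} (hl : ∀ i, ∀ u ∈ S i, l (PiLp.single 2 i u) ≤ 0) :
    (∀ w ∈ joinShape S, l w ≤ 0) ∧
      {w ∈ joinShape S | l w = 0} =
        joinShape fun i => {u ∈ S i | l (PiLp.single 2 i u) = 0} := by
  have hsm : ∀ i (r : ℝ) (u : E i), l (PiLp.single 2 i (r • u)) = r * l (PiLp.single 2 i u) := by
    intro i r u
    rw [single_smul', map_smul, smul_eq_mul]
  have hz : ∀ i, l (PiLp.single 2 i (0 : E i)) = 0 := by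
    intro i
    have := hsm i 0 0
    rwa [zero_smul, zero_mul] at this
  have hle : ∀ w ∈ joinShape S, ∀ i, l (PiLp.single 2 i (w i)) ≤ 0 := by
    intro w hw i
    by_cases h0 : w i = 0
    · rw [h0, hz]
    · have := hl i _ (hw.2 i h0)
      rw [hsm] at this
      have hp : 0 < ‖w i‖⁻¹ := by positivity
      nlinarith
  have hsum : ∀ w : PiLp 2 E, l w = ∑ i, l (PiLp.single 2 i (w i)) := by
    intro w
    rw [← map_sum, sum_single_eq]
  refine ⟨fun w hw => ?_, ?_⟩
  · rw [hsum]; exact Finset.sum_nonpos fun i _ => hle w hw i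
  · ext w
    constructor
    · rintro ⟨hw, h0⟩
      rw [hsum, Finset.sum_eq_zero_iff_of_nonpos fun i _ => hle w hw i] at h0
      exact ⟨hw.1, fun i hi => ⟨hw.2 i hi, by rw [hsm, h0 i (Finset.mem_univ i), mul_zero]⟩⟩
    · rintro ⟨h1, h2⟩
      refine ⟨⟨h1, fun i hi => (h2 i hi).1⟩, ?_⟩
      rw [hsum]
      refine Finset.sum_eq_zero fun i _ => ?_
      by_cases h0 : w i = 0
      · rw [h0, hz]
      · have := (h2 i h0).2
        rw [hsm] at this
        exact (mul_eq_zero.1 this).resolve_left (inv_ne_zero (norm_ne_zero_iff.2 h0))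

/-- The direct sum of linear isometries. -/
noncomputable def piIsometry (g : ∀ i, E i →ₗᵢ[ℝ] F i) : PiLp 2 E →ₗᵢ[ℝ] PiLp 2 F where
  toFun w := WithLp.toLp 2 fun i => g i (w i)
  map_add' v w := by ext i; simp
  map_smul' r w := by ext i; simp
  norm_map' w := by simp [PiLp.norm_eq_of_L2]

@[simp]
theorem piIsometry_apply (g : ∀ i, E i →ₗᵢ[ℝ] F i) (w : PiLp 2 E) (i : ι) :
    piIsometry g w i = g i (w i) := rfl

theorem piIsometry_image (g : ∀ i, E i →ₗᵢ[ℝ] F i) (S : ∀ i, Set (E i)) :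
    piIsometry g '' joinShape S = joinShape fun i => g i '' S i := by
  ext w
  constructor
  · rintro ⟨v, ⟨h1, h2⟩, rfl⟩
    refine ⟨by rw [LinearIsometry.norm_map, h1], fun i hi => ?_⟩
    rw [piIsometry_apply] at hi ⊢
    refine ⟨_, h2 i fun h => hi (by rw [h, map_zero]), ?_⟩
    rw [map_smul, LinearIsometry.norm_map]
  · rintro ⟨h1, h2⟩
    have h3 : ∀ i, ∃ v : E i, g i v = w i ∧ (v ≠ 0 → ‖v‖⁻¹ • v ∈ S i) := by
      intro i
      by_cases h0 : w i = 0
      · exact ⟨0, by simp [h0], fun h => absurd rfl h⟩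
      · obtain ⟨u, hu, he⟩ := h2 i h0
        have hn : ‖w i‖ ≠ 0 := norm_ne_zero_iff.2 h0
        have e : g i (‖w i‖ • u) = w i := by
          rw [map_smul, he, smul_smul, mul_inv_cancel₀ hn, one_smul]
        refine ⟨‖w i‖ • u, e, fun _ => ?_⟩
        rw [← (g i).norm_map, e, smul_smul, inv_mul_cancel₀ hn, one_smul]
        exact hu
    choose v hv hv' using h3
    have e : piIsometry g (WithLp.toLp 2 v) = w := by
      ext i; exact hv i
    exact ⟨WithLp.toLp 2 v, ⟨by rw [← (piIsometry g).norm_map, e, h1], hv'⟩, e⟩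

end Join

theorem PSComplex.norm_eq_one (K : PSComplex) {c : K.Cell} {u : K.E c} (hu : u ∈ K.shape c) :
    ‖u‖ = 1 := by
  obtain ⟨V, -, hV⟩ := (K.isPolytope c).1
  rw [hV] at hu
  exact hu.1

theorem PSComplex.norm_eq_one' (K : PSComplex) {c d : K.Cell} (h : c ≤ d) {u : K.E d}
    (hu : u ∈ K.glue h '' K.shape c) : ‖u‖ = 1 := by
  obtain ⟨v, hv, rfl⟩ := hu
  rw [LinearIsometry.norm_map, K.norm_eq_one hv]

/-- The spherical join of a finite family of piecewise spherical complexes. Its cells are the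
spherical joins of cells of the factors (the empty cells included). -/
noncomputable def sphericalJoin {ι : Type} [Fintype ι] (K : ι → PSComplex) : PSComplex where
  Cell := ∀ i, (K i).Cell
  order := Pi.partialOrder
  E c := PiLp 2 fun i => (K i).E (c i)
  shape c := joinShape fun i => (K i).shape (c i)
  isPolytope c := isSphericalPolytope_joinShape fun i => (K i).isPolytope (c i)
  glue {c d} h := piIsometry fun i => (K i).glue (c := c i) (d := d i) (h i)
  glue_refl c w := by ext i; exact (K i).glue_refl _ _
  glue_trans h h' w := by ext i; exact (K i).glue_trans _ _ _
  glue_face {c d} h := by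
    classical
    choose l hl he using fun i => (K i).glue_face (h i)
    have hsingle : ∀ i (u : (K i).E (d i)),
        (∑ j, (l j).comp (PiLp.proj 2 (fun i => (K i).E (d i)) j)) (PiLp.single 2 i u) =
          l i u := by
      intro i u
      rw [_root_.sum_apply, Finset.sum_eq_single i]
      · simp
      · intro j _ hj
        simp [PiLp.single_eq_of_ne 2 hj]
      · simp
    obtain ⟨h1, h2⟩ := joinShape_face (S := fun i => (K i).shape (d i))
      (l := ∑ j, (l j).comp (PiLp.proj 2 (fun i => (K i).E (d i)) j))
      (fun i u hu => by rw [hsingle]; exact hl i u hu)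
    refine ⟨_, h1, ?_⟩
    rw [h2, piIsometry_image]
    congr 1
    funext i
    simp only [hsingle]
    exact he i
  exists_face d B hB := by
    classical
    obtain ⟨l, hl, rfl⟩ := hB
    have hl' : ∀ i, ∀ u ∈ (K i).shape (d i), l (PiLp.single 2 i u) ≤ 0 := fun i u hu =>
      hl _ ((single_mem_joinShape (S := fun i => (K i).shape (d i))
        ((K i).norm_eq_one hu)).2 hu)
    rw [(joinShape_face hl').2]
    have := fun i => (K i).exists_face (d i) {u ∈ (K i).shape (d i) | l (PiLp.single 2 i u) = 0}
      ⟨l.comp (LinearMap.toContinuousLinearMap (singleLinear (E := fun i => (K i).E (d i)) i)), hl' i, rfl⟩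
    choose c hc he using this
    refine ⟨c, hc, ?_⟩
    rw [piIsometry_image]
    congr 1
    funext i
    exact he i
  face_unique {c c' d} h h' he := by
    classical
    rw [piIsometry_image, piIsometry_image] at he
    funext i
    refine (K i).face_unique (h i) (h' i) (Set.ext fun u => ?_)
    have key : ∀ {c : ∀ i, (K i).Cell} (h : c ≤ d), u ∈ (K i).glue (h i) '' (K i).shape (c i) ↔
        ‖u‖ = 1 ∧ (PiLp.single 2 i u : PiLp 2 fun i => (K i).E (d i)) ∈
          joinShape fun i => (K i).glue (h i) '' (K i).shape (c i) := by
      intro c h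
      constructor
      · intro hu
        have h1 := (K i).norm_eq_one' (h i) hu
        exact ⟨h1, (single_mem_joinShape
          (S := fun i => (K i).glue (h i) '' (K i).shape (c i)) h1).2 hu⟩
      · rintro ⟨h1, h2⟩
        exact (single_mem_joinShape
          (S := fun i => (K i).glue (h i) '' (K i).shape (c i)) h1).1 h2
    rw [key h, key h', he]
  inter c d := by
    choose g hg using fun i => (K i).inter (c i) (d i)
    refine ⟨g, ?_, fun e he i => (hg i).2 ?_⟩
    · rintro _ (rfl | rfl)
      exacts [fun i => (hg i).1 (Or.inl rfl), fun i => (hg i).1 (Or.inr rfl)]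
    · rintro _ (rfl | rfl)
      exacts [he (Or.inl rfl) i, he (Or.inr rfl) i]
  emptyCell i := (K i).emptyCell
  shape_emptyCell := by
    refine Set.eq_empty_of_forall_notMem ?_
    rintro w ⟨h1, h2⟩
    have : w = 0 := by
      ext i
      by_contra h
      have := h2 i h
      exact ((K i).shape_emptyCell.subset this).elim
    simp [this] at h1
  emptyCell_le c i := (K i).emptyCell_le (c i)

/-! ### The underlying metric space of a piecewise spherical complex -/

namespace PSComplex

/-- The underlying space of a piecewise spherical complex: the disjoint union of its polytopes,
with points identified along the gluing isometries. -/
def Space (K : PSComplex) : Type _ :=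
  Quot fun p q : (c : K.Cell) × K.shape c => ∃ h : p.1 ≤ q.1, K.glue h p.2 = (q.2 : K.E q.1)

/-- The point of the underlying space given by a point of a cell. -/
def point (K : PSComplex) (c : K.Cell) (u : K.shape c) : K.Space := Quot.mk _ ⟨c, u⟩

/-- `K.Joined p q r`: there is a finite string of points from `p` to `q` of total length `r`, any two
successive points of which lie in a common cell; the length of a step is the spherical distance
(the angle) in that cell. -/
inductive Joined (K : PSComplex) : K.Space → K.Space → ℝ → Prop
  | refl (p : K.Space) : Joined K p p 0
  | step (c : K.Cell) (u v : K.shape c) (q : K.Space) (r : ℝ) (h : Joined K (K.point c v) q r) :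
      Joined K (K.point c u) q (InnerProductGeometry.angle (u : K.E c) (v : K.E c) + r)

/-- The intrinsic distance on the underlying space: the infimum of the lengths of strings
(infinite if there is none). -/
noncomputable def dist (K : PSComplex) (p q : K.Space) : ENNReal :=
  ⨅ (r : ℝ) (_ : K.Joined p q r), ENNReal.ofReal r

/-- Two piecewise spherical complexes are identified if there is a bijection of their underlying
spaces that preserves intrinsic distances and that maps each cell of `K` isometrically (for the
spherical distance in the cells) onto a cell of `L`, inducing an isomorphism of the posets of
cells. -/
structure Iso (K L : PSComplex) where
  toEquiv : K.Space ≃ L.Space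
  dist_eq : ∀ p q : K.Space, L.dist (toEquiv p) (toEquiv q) = K.dist p q
  cellEquiv : K.Cell ≃o L.Cell
  cellMap : ∀ c : K.Cell, K.shape c ≃ L.shape (cellEquiv c)
  angle_eq : ∀ (c : K.Cell) (u v : K.shape c),
    InnerProductGeometry.angle (cellMap c u : L.E (cellEquiv c)) (cellMap c v) =
      InnerProductGeometry.angle (u : K.E c) (v : K.E c)
  map_point : ∀ (c : K.Cell) (u : K.shape c),
    toEquiv (K.point c u) = L.point (cellEquiv c) (cellMap c u)

end PSComplex

/-! ### Orthoscheme complexes -/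

/-- The vertex `v_j = e_1 + ⋯ + e_j` of a standard `n`-orthoscheme `ortho(v_0, …, v_n)` in `ℝⁿ`:
the successive differences `v_j - v_{j-1}` are the standard orthonormal basis. -/
noncomputable def orthoschemeVertex (n j : ℕ) : EuclideanSpace ℝ (Fin n) :=
  WithLp.toLp 2 fun i => if (i : ℕ) < j then 1 else 0

theorem exists_functional (n : ℕ) (g : ℕ → ℝ) :
    ∃ l : EuclideanSpace ℝ (Fin n) →L[ℝ] ℝ,
      ∀ j ≤ n, l (orthoschemeVertex n j) = g j - g 0 := by
  refine ⟨∑ i : Fin n, (g (i + 1) - g i) • EuclideanSpace.proj i, fun j hj => ?_⟩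
  have e : ∀ i : Fin n, ((g (i + 1) - g i) • EuclideanSpace.proj i : EuclideanSpace ℝ (Fin n) →L[ℝ] ℝ)
      (orthoschemeVertex n j) = if (i : ℕ) < j then g (i + 1) - g i else 0 := by
    intro i
    simp [orthoschemeVertex]
  rw [_root_.sum_apply, Finset.sum_congr rfl fun i _ => e i,
    Fin.sum_univ_eq_sum_range (fun i => if i < j then g (i + 1) - g i else 0),
    ← Finset.sum_filter]
  have : (Finset.range n).filter (· < j) = Finset.range j := by
    ext i; simp; omega
  rw [this, Finset.sum_range_sub]

theorem exists_max_eq_of_exposed {E : Type*} [NormedAddCommGroup E] [InnerProductSpace ℝ E]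
    [FiniteDimensional ℝ E] {V B : Set E} (hB : IsExposed ℝ (convexHull ℝ V) B) (hne : B.Nonempty) :
    ∃ W ⊆ V, B = convexHull ℝ W := by
  obtain ⟨l, hl⟩ := hB hne
  obtain ⟨x, hx⟩ := hne
  have hxB := hx
  rw [hl] at hx
  refine ⟨{v ∈ V | l v = l x}, Set.sep_subset _ _, ?_⟩
  rw [← convexHull_inter_max fun v hv => hx.2 v (subset_convexHull ℝ V hv)]
  ext y
  constructor
  · intro hy
    rw [hl] at hy
    exact ⟨hy.1, le_antisymm (hx.2 y hy.1) (hy.2 x hx.1)⟩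
  · rintro ⟨hy, he⟩
    exact (apply_le_of_exposed hl hxB hy).2.1 he

section Orthoscheme

variable {P : Type u} [PartialOrder P] [BoundedOrder P]

/-- The position of the vertex of an element `x` of a bounded graded poset in a standard
orthoscheme. In a maximal chain `x_0 < ⋯ < x_n` the element `x_j` has rank `j`, so it is placed
at `v_j`. -/
noncomputable def IsGraded.vertex (hP : IsGraded P) (x : P) :
    EuclideanSpace ℝ (Fin (hP.rank ⊤)) :=
  orthoschemeVertex (hP.rank ⊤) (hP.rank x)

/-- For a subset of a finite chain there is a functional that is maximal exactly on it. -/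
theorem IsGraded.exists_functional (hP : IsGraded P) (s t : Set P) (hs : IsChain (· ≤ ·) s)
    (hts : t ⊆ s) : ∃ (l : EuclideanSpace ℝ (Fin (hP.rank ⊤)) →L[ℝ] ℝ) (M : ℝ),
      ∀ x ∈ s, l (hP.vertex x) ≤ M ∧ (l (hP.vertex x) = M ↔ x ∈ t) := by
  classical
  obtain ⟨l, hl⟩ := _root_.exists_functional (hP.rank ⊤)
    fun j => if j ∈ hP.rank '' t then (0 : ℝ) else -1
  refine ⟨l, 0 - (if 0 ∈ hP.rank '' t then (0 : ℝ) else -1), fun x hx => ?_⟩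
  have e := hl (hP.rank x) (hP.rank_strictMono.monotone le_top)
  have hmem : hP.rank x ∈ hP.rank '' t ↔ x ∈ t := by
    constructor
    · rintro ⟨y, hy, he⟩
      by_contra hne
      have hxy : y ≠ x := by rintro rfl; exact hne hy
      rcases hs.total (hts hy) hx with h | h
      · exact absurd he (hP.rank_strictMono (lt_of_le_of_ne h hxy)).ne
      · exact absurd he (hP.rank_strictMono (lt_of_le_of_ne h hxy.symm)).ne'
    · exact fun h => ⟨x, h, rfl⟩
  rw [IsGraded.vertex, e]
  by_cases h : x ∈ t
  · rw [if_pos (hmem.2 h)]; exact ⟨le_rfl, by simp [h]⟩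
  · rw [if_neg (mt hmem.1 h)]
    exact ⟨by linarith, ⟨fun h' => by linarith, fun h' => absurd h' h⟩⟩

theorem IsGraded.exposed (hP : IsGraded P) {s t : Set P} (hs : IsChain (· ≤ ·) s) (hts : t ⊆ s) :
    IsExposed ℝ (convexHull ℝ (hP.vertex '' s)) (convexHull ℝ (hP.vertex '' t)) := by
  intro hne
  obtain ⟨l, M, h⟩ := hP.exists_functional s t hs hts
  refine ⟨l, ?_⟩
  have hM : ∀ v ∈ hP.vertex '' s, l v ≤ M := by
    rintro _ ⟨x, hx, rfl⟩; exact (h x hx).1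
  have e : {v ∈ hP.vertex '' s | l v = M} = hP.vertex '' t := by
    ext v
    constructor
    · rintro ⟨⟨x, hx, rfl⟩, he⟩; exact ⟨x, (h x hx).2.1 he, rfl⟩
    · rintro ⟨x, hx, rfl⟩; exact ⟨⟨x, hts hx, rfl⟩, (h x (hts hx)).2.2 hx⟩
  have hle : ∀ y ∈ convexHull ℝ (hP.vertex '' s), l y ≤ M :=
    fun y hy => convexHull_min (t := {v | l v ≤ M}) hM
      (convex_halfSpace_le (l : EuclideanSpace ℝ (Fin (hP.rank ⊤)) →ₗ[ℝ] ℝ).isLinear M) hy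
  rw [← e, ← convexHull_inter_max hM]
  rw [← e, ← convexHull_inter_max hM] at hne
  obtain ⟨z, hz, hzM⟩ := hne
  ext y
  refine and_congr_right fun hy => ⟨fun he w hw => he ▸ hle w hw, fun hm => ?_⟩
  exact le_antisymm (hle y hy) (hzM ▸ hm z hz)

theorem IsGraded.vertex_mem_iff (hP : IsGraded P) {s t : Set P} (hs : IsChain (· ≤ ·) s)
    (hts : t ⊆ s) {x : P} (hx : x ∈ s) :
    hP.vertex x ∈ convexHull ℝ (hP.vertex '' t) ↔ x ∈ t := by
  refine ⟨fun h => ?_, fun h => subset_convexHull ℝ _ ⟨x, h, rfl⟩⟩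
  obtain ⟨l, M, hl⟩ := hP.exists_functional s t hs hts
  have : convexHull ℝ (hP.vertex '' t) ⊆ {y | l y = M} := by
    refine convexHull_min ?_
      (convex_hyperplane (l : EuclideanSpace ℝ (Fin (hP.rank ⊤)) →ₗ[ℝ] ℝ).isLinear M)
    rintro _ ⟨y, hy, rfl⟩
    exact (hl y (hts hy)).2.2 hy
  exact (hl x hx).2.1 (this h)

/-- The orthoscheme complex of a bounded graded poset: the order complex, whose cells are the
nonempty finite chains, in which the simplex of a maximal chain `x_0 < ⋯ < x_n` has the metric of
the standard orthoscheme `ortho(v_0, …, v_n)` with `x_j` placed at `v_j`, and the simplex of a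
subchain is the corresponding face. All these simplices are given inside the same `ℝⁿ`, and a
simplex is glued to the simplices of larger chains by the identity of `ℝⁿ`. -/
noncomputable def orthoschemeComplex (hP : IsGraded P) : PEComplex where
  Cell := {s : Set P // s.Finite ∧ s.Nonempty ∧ IsChain (· ≤ ·) s}
  E _ := EuclideanSpace ℝ (Fin (hP.rank ⊤))
  polytope s := convexHull ℝ (hP.vertex '' s.1)
  isPolytope s := ⟨_, s.2.1.image _, s.2.2.1.image _, rfl⟩
  glue _ := AffineIsometry.id
  glue_refl _ _ := rfl
  glue_trans _ _ _ := rfl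
  glue_face {s t} h := by
    simpa using hP.exposed t.2.2.2 h
  exists_face t B hB hne := by
    obtain ⟨W, hW, rfl⟩ := exists_max_eq_of_exposed hB hne
    obtain ⟨s, hs, rfl⟩ := Set.subset_image_iff.1 hW
    refine ⟨⟨s, t.2.1.subset hs, ?_, t.2.2.2.mono hs⟩, hs, by simp⟩
    exact Set.image_nonempty.1 (convexHull_nonempty_iff.1 hne)
  face_unique {s s' t} h h' he := by
    have he' : convexHull ℝ (hP.vertex '' s.1) = convexHull ℝ (hP.vertex '' s'.1) := by
      simpa using he
    ext x
    constructor
    · intro hx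
      rw [← hP.vertex_mem_iff t.2.2.2 h' (h hx), ← he', hP.vertex_mem_iff t.2.2.2 h (h hx)]
      exact hx
    · intro hx
      rw [← hP.vertex_mem_iff t.2.2.2 h (h' hx), he', hP.vertex_mem_iff t.2.2.2 h' (h' hx)]
      exact hx
  inter r s t hs ht := by
    refine ⟨⟨s.1 ∩ t.1, s.2.1.subset Set.inter_subset_left, r.2.2.1.mono (Set.subset_inter hs ht),
      s.2.2.2.mono Set.inter_subset_left⟩, ?_, fun e he => Set.subset_inter ?_ ?_⟩
    · rintro _ (rfl | rfl)
      exacts [Set.inter_subset_left, Set.inter_subset_right]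
    exacts [he (Or.inl rfl), he (Or.inr rfl)]

/-- The simplex of a chain `x_0 < ⋯ < x_k`. -/
def chainSimplex (hP : IsGraded P) {k : ℕ} (x : Fin (k + 1) → P) (hx : StrictMono x) :
    (orthoschemeComplex hP).Cell :=
  ⟨Set.range x, Set.finite_range x, Set.range_nonempty x, hx.monotone.isChain_range⟩

/-- The vertex `v_x`. -/
def vertexCell (hP : IsGraded P) (x : P) : (orthoschemeComplex hP).Cell :=
  ⟨{x}, Set.finite_singleton x, Set.singleton_nonempty x, IsChain.singleton⟩

/-- The edge `e_{xy}` for `x < y`. -/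
def edgeCell (hP : IsGraded P) {x y : P} (hxy : x < y) : (orthoschemeComplex hP).Cell :=
  ⟨{x, y}, Set.toFinite _, Set.insert_nonempty _ _, IsChain.pair hxy.le⟩

end Orthoscheme

section Local

variable {P : Type u} [PartialOrder P]

/-- The local endpoint link `lk(v_b, |P(a, b)|)`. -/
noncomputable def IsGraded.upperEndpointLink (hP : IsGraded P) {a b : P} (h : a ≤ b) :
    PSComplex.{u} :=
  haveI : Fact (a ≤ b) := ⟨h⟩
  (orthoschemeComplex (hP.interval a b)).link (vertexCell (hP.interval a b) ⟨b, h, le_rfl⟩)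

/-- The local endpoint link `lk(v_a, |P(a, b)|)`. -/
noncomputable def IsGraded.lowerEndpointLink (hP : IsGraded P) {a b : P} (h : a ≤ b) :
    PSComplex.{u} :=
  haveI : Fact (a ≤ b) := ⟨h⟩
  (orthoschemeComplex (hP.interval a b)).link (vertexCell (hP.interval a b) ⟨a, le_rfl, h⟩)

/-- The local diagonal link `lk(e_{ab}, |P(a, b)|)`. -/
noncomputable def IsGraded.diagonalLink (hP : IsGraded P) {a b : P} (h : a < b) :
    PSComplex.{u} :=
  haveI : Fact (a ≤ b) := ⟨h.le⟩
  (orthoschemeComplex (hP.interval a b)).link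
    (edgeCell (hP.interval a b) (x := ⟨a, le_rfl, h.le⟩) (y := ⟨b, h.le, le_rfl⟩) h)

end Local

/-! The proof rests on a splitting of `ℝⁿ` into coordinate blocks. Every simplex of the orthoscheme
complex sits in one `ℝⁿ`, with an element of rank `r` at `e₁ + ⋯ + e_r`, and all gluing maps are the
identity. A chain containing `σ` is cut by `σ` into chains of the intervals between consecutive
elements of `σ` and the two bounds. Ranks add along the cuts (`HasRank.add`,
`IsGraded.rank_interval`), so the vertices from an interval `[a, b]` form a translate, by the vertex
of `a`, of their positions in the orthoscheme complex of `[a, b]`, embedded in the coordinates from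
`rank a` to `rank b - 1`. Different intervals use disjoint blocks.

By `faceLink_eq`, the link of a face in a polytope consists of the unit vectors in the cone
generated by the components of the vertices perpendicular to the face. The directions of `σ` are
compatible with the blocks: seen from the block of `[a, b]`, each vertex of `σ` looks like an
endpoint of that interval lying in `σ`. Hence the perpendicular components can be computed block by
block, the cone is the orthogonal sum of the cones of the intervals, and its unit vectors form the
spherical join (`image_joinShape_hull`, `faceLink_eq_image_joinShape`).

On cells, a chain containing `σ` is the same as a family of chains in the intervals, each containing
the trace of `σ` (`linkCellEquiv`). One linear isometry serves all cells at once and commutes with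
the gluing, and such a cellwise isometry preserves the intrinsic distances because it carries
strings to strings of equal length (`isoOfLinearIsometry`). -/

/-! ### Isometries of piecewise spherical complexes from isometries of the cells -/

namespace PSComplex

section IsoOfCells

variable {K L : PSComplex} (e : K.Cell ≃o L.Cell) (f : ∀ c, K.shape c ≃ L.shape (e c))

/-- Each step of a string lies in a single cell, so preserving angles cell by cell preserves the
length of the whole string. -/
theorem Joined.map {g : K.Space → L.Space}
    (hangle : ∀ c (u v : K.shape c), InnerProductGeometry.angle (f c u : L.E (e c)) (f c v) =
      InnerProductGeometry.angle (u : K.E c) (v : K.E c))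
    (hg : ∀ c u, g (K.point c u) = L.point (e c) (f c u)) {p q : K.Space} {r : ℝ}
    (h : K.Joined p q r) : L.Joined (g p) (g q) r := by
  induction h with
  | refl p => exact .refl _
  | step c u v q r _ ih =>
    rw [hg] at ih ⊢
    rw [← hangle]
    exact .step _ _ _ _ _ ih

/-- Cells and their points lift along the bijections `e` and `f`; injectivity of `g` makes the
lifted steps fit together, since consecutive steps meet in the space and not in a common cell. The
endpoints enter through equations so that the induction can move the starting point. -/
theorem Joined.comap {g : K.Space → L.Space} (hinj : Function.Injective g)
    (hangle : ∀ c (u v : K.shape c), InnerProductGeometry.angle (f c u : L.E (e c)) (f c v) =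
      InnerProductGeometry.angle (u : K.E c) (v : K.E c))
    (hg : ∀ c u, g (K.point c u) = L.point (e c) (f c u)) {p' q' : L.Space} {r : ℝ}
    (h : L.Joined p' q' r) {p q : K.Space} (hp : g p = p') (hq : g q = q') :
    K.Joined p q r := by
  induction h generalizing p with
  | refl p' => exact hinj (hp.trans hq.symm) ▸ .refl p
  | step c' u' v' q' r _ ih =>
    obtain ⟨c, rfl⟩ := e.surjective c'
    obtain ⟨u, rfl⟩ := (f c).surjective u'
    obtain ⟨v, rfl⟩ := (f c).surjective v'
    obtain rfl := hinj (hp.trans (hg c u).symm)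
    rw [hangle]
    exact .step _ _ _ _ _ (ih (hg c v) hq)

/-- Bijections between the cells that preserve angles and are compatible with the gluing
isometries form an isometry of complexes. -/
def isoOfCells
    (hangle : ∀ c (u v : K.shape c), InnerProductGeometry.angle (f c u : L.E (e c)) (f c v) =
      InnerProductGeometry.angle (u : K.E c) (v : K.E c))
    (hglue : ∀ {c d : K.Cell} (h : c ≤ d) (u : K.shape c) (v : K.shape d),
      K.glue h u = (v : K.E d) ↔
        L.glue (e.monotone h) (f c u : L.E (e c)) = (f d v : L.E (e d))) : Iso K L :=
  -- An equivalence of quotients needs the generating relations to correspond in both directions,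
  -- hence the "iff" in `hglue`.
  let g : K.Space ≃ L.Space := Quot.congr (Equiv.sigmaCongr e.toEquiv f) fun _ _ =>
    ⟨fun ⟨h, h'⟩ => ⟨e.monotone h, (hglue h _ _).1 h'⟩,
      fun ⟨h, h'⟩ => ⟨e.le_iff_le.1 h, (hglue _ _ _).2 h'⟩⟩
  { toEquiv := g
    -- The two infima run over the same set of lengths.
    dist_eq := fun _ _ => iInf_congr fun _ =>
      iInf_congr_Prop ⟨fun h => h.comap e f g.injective hangle (fun _ _ => rfl) rfl rfl,
        fun h => h.map e f hangle fun _ _ => rfl⟩ fun _ => rfl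
    cellEquiv := e
    cellMap := f
    angle_eq := hangle
    map_point := fun _ _ => rfl }

/-- Linear isometries that carry the cells of `L` onto those of `K` and commute with the gluing
isometries form an isometry of complexes. -/
noncomputable def isoOfLinearIsometry (φ : ∀ c, L.E (e c) →ₗᵢ[ℝ] K.E c)
    (hφ : ∀ c, φ c '' L.shape (e c) = K.shape c)
    (hglue : ∀ {c d : K.Cell} (h : c ≤ d) (w : L.E (e c)),
      φ d (L.glue (e.monotone h) w) = K.glue h (φ c w)) : Iso K L :=
  -- The maps `φ c` are not assumed surjective; only their restrictions to the shapes are inverted.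
  let f (c : K.Cell) : K.shape c ≃ L.shape (e c) :=
    ((Equiv.Set.image (φ c) (L.shape (e c)) (φ c).injective).trans (Equiv.setCongr (hφ c))).symm
  have hf (c : K.Cell) (u : K.shape c) : φ c (f c u) = u :=
    congrArg Subtype.val ((f c).symm_apply_apply u)
  isoOfCells e f (fun c u v => by rw [← (φ c).angle_map, hf, hf]) fun {c d} h u v => by
    rw [← (φ d).injective.eq_iff, hglue, hf, hf]

end IsoOfCells

end PSComplex

/-! ### The link of an orthogonal sum of faces -/

section FaceLinkJoin

open InnerProductSpace

/-- The sum of an orthogonal family of linear isometries. -/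
noncomputable def OrthogonalFamily.piLpIsometry {ι : Type*} [Fintype ι] {G : ι → Type*} {E : Type*}
    [∀ i, NormedAddCommGroup (G i)] [∀ i, InnerProductSpace ℝ (G i)]
    [NormedAddCommGroup E] [InnerProductSpace ℝ E] {V : ∀ i, G i →ₗᵢ[ℝ] E}
    (hV : OrthogonalFamily ℝ G V) : PiLp 2 G →ₗᵢ[ℝ] E where
  toFun w := ∑ i, V i (w i)
  map_add' v w := by simp [Finset.sum_add_distrib]
  map_smul' r w := by simp [Finset.smul_sum]
  norm_map' w := by
    change ‖∑ i, V i (w i)‖ = ‖w‖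
    rw [← sq_eq_sq₀ (norm_nonneg _) (norm_nonneg _), PiLp.norm_sq_eq_of_L2]
    exact hV.norm_sum (fun i => w i) Finset.univ

/-- For shapes cut out by cones the normalisation in `joinShape` disappears, so a join becomes the
unit sphere of a direct sum of cones. -/
theorem mem_joinShape_hull {ι : Type*} [Fintype ι] {G : ι → Type*}
    [∀ i, NormedAddCommGroup (G i)] [∀ i, InnerProductSpace ℝ (G i)] (C : ∀ i, Set (G i))
    (w : PiLp 2 G) :
    w ∈ joinShape (fun i => {u | ‖u‖ = 1 ∧ u ∈ PointedCone.hull ℝ (C i)}) ↔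
      ‖w‖ = 1 ∧ ∀ i, w i ∈ PointedCone.hull ℝ (C i) :=
  and_congr_right fun _ => forall_congr' fun i => hull_iff_normalize (C i) (w i)

/-- The cone generated by a union is the sum of the cones generated by its members, and
orthogonality makes the sum map an isometry, so unit vectors correspond to unit vectors. -/
theorem image_joinShape_hull {ι : Type*} [Fintype ι] {G : ι → Type*} {E : Type*}
    [∀ i, NormedAddCommGroup (G i)] [∀ i, InnerProductSpace ℝ (G i)]
    [NormedAddCommGroup E] [InnerProductSpace ℝ E] {V : ∀ i, G i →ₗᵢ[ℝ] E}
    (hV : OrthogonalFamily ℝ G V) (C : ∀ i, Set (G i)) :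
    hV.piLpIsometry '' joinShape (fun i => {u | ‖u‖ = 1 ∧ u ∈ PointedCone.hull ℝ (C i)}) =
      {u | ‖u‖ = 1 ∧ u ∈ PointedCone.hull ℝ (⋃ i, V i '' C i)} := by
  classical
  ext u
  constructor
  · rintro ⟨w, hw, rfl⟩
    rw [mem_joinShape_hull] at hw
    refine ⟨by rw [LinearIsometry.norm_map, hw.1], sum_mem fun i _ => ?_⟩
    have hle : PointedCone.hull ℝ (C i) ≤
        (PointedCone.hull ℝ (⋃ i, V i '' C i)).comap (V i).toLinearMap :=
      Submodule.span_le.2 fun v hv =>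
        PointedCone.subset_hull (Set.mem_iUnion.2 ⟨i, v, hv, rfl⟩)
    exact hle (hw.2 i)
  · rintro ⟨h1, h2⟩
    obtain ⟨w, rfl, hw⟩ : ∃ w, hV.piLpIsometry w = u ∧ ∀ i, w i ∈ PointedCone.hull ℝ (C i) := by
      -- The induction ranges over the whole cone, where norms are arbitrary; the norm condition is
      -- recovered at the end from the isometry.
      clear h1
      induction h2 using Submodule.span_induction with
      | mem x hx =>
        obtain ⟨i, v, hv, rfl⟩ := Set.mem_iUnion.1 hx
        refine ⟨PiLp.single 2 i v, ?_, fun j => ?_⟩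
        · change ∑ j, V j ((PiLp.single 2 i v : PiLp 2 G) j) = V i v
          rw [Finset.sum_eq_single i]
          · simp
          · intro j _ hj
            rw [PiLp.single_eq_of_ne 2 hj, map_zero]
          · simp
        · by_cases hij : j = i
          · subst hij; simpa using PointedCone.subset_hull hv
          · rw [PiLp.single_eq_of_ne 2 hij]; exact zero_mem _
      | zero => exact ⟨0, map_zero _, fun i => zero_mem _⟩
      | add x y _ _ hx hy =>
        obtain ⟨v, rfl, hv⟩ := hx
        obtain ⟨w, rfl, hw⟩ := hy
        exact ⟨v + w, map_add _ _ _, fun i => add_mem (hv i) (hw i)⟩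
      | smul r x _ hx =>
        obtain ⟨v, rfl, hv⟩ := hx
        exact ⟨(r : ℝ) • v, map_smul _ _ _, fun i => Submodule.smul_mem _ r (hv i)⟩
    exact ⟨w, (mem_joinShape_hull C w).2 ⟨by rwa [LinearIsometry.norm_map] at h1, hw⟩, rfl⟩

theorem perp_eq_of_sub_mem {E : Type*} [NormedAddCommGroup E] [InnerProductSpace ℝ E]
    [FiniteDimensional ℝ E] {T : Set E} {y z : E} (hz : z ∈ (affineSpan ℝ T).directionᗮ)
    (h : y - z ∈ (affineSpan ℝ T).direction) : perp T y = z := by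
  rw [← sub_add_cancel y z, map_add, perp_eq_zero h, perp_eq_self hz, zero_add]

/-- The link of the face `conv A` of a polytope `conv B`, all of whose vertices lie in translates
of the pieces `conv (B i)` of an orthogonal family of subspaces, is the join of the links in the
pieces, provided that the vertices in `A` project to the faces `conv (A i)` of the pieces. -/
theorem faceLink_eq_image_joinShape {ι : Type*} [Fintype ι] {G : ι → Type*} {E : Type*}
    [∀ i, NormedAddCommGroup (G i)] [∀ i, InnerProductSpace ℝ (G i)]
    [∀ i, FiniteDimensional ℝ (G i)] [NormedAddCommGroup E] [InnerProductSpace ℝ E]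
    [FiniteDimensional ℝ E] {V : ∀ i, G i →ₗᵢ[ℝ] E} (hV : OrthogonalFamily ℝ G V)
    {A B : Set E} {A' B' : ∀ i, Set (G i)} (t : ι → E) (hAB : A ⊆ B) (hA : A.Nonempty)
    (hAB' : ∀ i, A' i ⊆ B' i) (hA' : ∀ i, (A' i).Nonempty)
    (hBt : ∀ i, ∀ z ∈ B' i, V i z + t i ∈ B) (hAt : ∀ i, ∀ z ∈ A' i, V i z + t i ∈ A)
    (hB : ∀ y ∈ B, ∃ i, ∃ z ∈ B' i, V i z + t i = y)
    (hadj : ∀ i, ∀ y ∈ A, ∃ z ∈ A' i, ∀ p, ⟪V i p, y⟫_ℝ = ⟪p, z⟫_ℝ) :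
    hV.piLpIsometry ''
        joinShape (fun i => faceLink (convexHull ℝ (A' i)) (convexHull ℝ (B' i))) =
      faceLink (convexHull ℝ A) (convexHull ℝ B) := by
  obtain ⟨x, hx⟩ := (hA.convexHull (𝕜 := ℝ)).intrinsicInterior (convex_convexHull ℝ A)
  choose x' hx' using fun i =>
    ((hA' i).convexHull (𝕜 := ℝ)).intrinsicInterior (convex_convexHull ℝ (A' i))
  -- The translation `t i` cancels in differences of vertices.
  have hdir : ∀ i, ∀ w ∈ (affineSpan ℝ (convexHull ℝ (A' i))).direction,
      V i w ∈ (affineSpan ℝ (convexHull ℝ A)).direction := by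
    intro i w hw
    rw [affineSpan_convexHull, direction_affineSpan] at hw ⊢
    have : vectorSpan ℝ (A' i) ≤ (vectorSpan ℝ A).comap (V i).toLinearMap := by
      refine Submodule.span_le.2 ?_
      rintro _ ⟨a, ha, b, hb, rfl⟩
      have := vsub_mem_vectorSpan ℝ (hAt i a ha) (hAt i b hb)
      simpa using this
    exact this hw
  -- By `hadj`, pairing `V i p` with a difference of points of `A` is pairing `p` with a difference
  -- of points of `A' i`, which vanishes.
  have horth : ∀ i, ∀ p ∈ (affineSpan ℝ (convexHull ℝ (A' i))).directionᗮ,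
      V i p ∈ (affineSpan ℝ (convexHull ℝ A)).directionᗮ := by
    intro i p hp
    rw [affineSpan_convexHull, direction_affineSpan, Submodule.mem_orthogonal'] at hp ⊢
    intro w hw
    have : vectorSpan ℝ A ≤ (ℝ ∙ V i p)ᗮ := by
      refine Submodule.span_le.2 ?_
      rintro _ ⟨a, ha, b, hb, rfl⟩
      obtain ⟨a', ha', hae⟩ := hadj i a ha
      obtain ⟨b', hb', hbe⟩ := hadj i b hb
      change a - b ∈ _
      rw [SetLike.mem_coe, Submodule.mem_orthogonal_singleton_iff_inner_right, inner_sub_right,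
        hae, hbe, ← inner_sub_right]
      exact hp _ (vsub_mem_vectorSpan ℝ ha' hb')
    exact Submodule.mem_orthogonal_singleton_iff_inner_right.1 (this hw)
  -- `V i` respects both halves of the orthogonal decomposition, so it commutes with the projection.
  have hperp : ∀ i (w : G i), perp (convexHull ℝ A) (V i w) = V i (perp (convexHull ℝ (A' i)) w) :=
    fun i w => perp_eq_of_sub_mem (horth i _ (perp_mem _ _)) (by
      rw [← map_sub]; exact hdir i _ (sub_perp_mem _ _))
  -- The perpendicular component does not depend on the base point in the face, so both base points
  -- are moved to a vertex `a` of `A' i` and its translate in `A`.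
  have hpt : ∀ i (z : G i), perp (convexHull ℝ A) (V i z + t i - x) =
      V i (perp (convexHull ℝ (A' i)) (z - x' i)) := by
    intro i z
    obtain ⟨a, ha⟩ := hA' i
    rw [perp_sub_eq (intrinsicInterior_subset hx) (subset_convexHull ℝ A (hAt i a ha)),
      perp_sub_eq (intrinsicInterior_subset (hx' i)) (subset_convexHull ℝ _ ha), ← hperp,
      add_sub_add_right_eq_sub, ← map_sub]
  rw [funext fun i => faceLink_eq (convex_convexHull ℝ (B' i)) (convexHull_mono (hAB' i)) rfl
    (hx' i), image_joinShape_hull, faceLink_eq (convex_convexHull ℝ B) (convexHull_mono hAB) rfl hx]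
  -- Both sides are the unit vectors of a cone; it remains to match the generating sets.
  congr! 5
  ext v
  simp only [Set.mem_iUnion, Set.mem_image]
  constructor
  · rintro ⟨i, _, ⟨z, hz, rfl⟩, rfl⟩
    exact ⟨_, hBt i z hz, hpt i z⟩
  · rintro ⟨y, hy, rfl⟩
    obtain ⟨i, z, hz, rfl⟩ := hB y hy
    exact ⟨i, _, ⟨z, hz, rfl⟩, (hpt i z).symm⟩

end FaceLinkJoin

/-! ### Ranks in intervals -/

/-- The part of a maximal chain in an interval is a maximal chain of the interval if each of the
other elements of the chain is below or above the whole interval. -/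
theorem IsMaxChain.preimage_Icc {P : Type*} [PartialOrder P] {M : Set P}
    (hM : IsMaxChain (· ≤ ·) M) {a b : P}
    (h : ∀ z ∈ M, z ∉ Set.Icc a b → (∀ w ∈ Set.Icc a b, z ≤ w) ∨ ∀ w ∈ Set.Icc a b, w ≤ z) :
    IsMaxChain (· ≤ ·) (Subtype.val ⁻¹' M : Set (Set.Icc a b)) := by
  refine ⟨fun x hx y hy hxy => hM.1 hx hy fun h => hxy (Subtype.ext h), fun t ht hMt => ?_⟩
  -- A larger chain `t` of the interval can be added to `M` without losing comparability, so
  -- maximality of `M` absorbs it.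
  have hc : IsChain (· ≤ ·) (M ∪ Subtype.val '' t) := by
    have key : ∀ x ∈ M, ∀ y ∈ t, x ≤ y ∨ y ≤ x := by
      intro x hx y hy
      by_cases hxI : x ∈ Set.Icc a b
      · exact ht.total (hMt (show (⟨x, hxI⟩ : Set.Icc a b) ∈ _ from hx)) hy
      · exact (h x hx hxI).imp (fun h => h y y.2) fun h => h y y.2
    rintro x (hx | ⟨x, hx, rfl⟩) y (hy | ⟨y, hy, rfl⟩) -
    · exact hM.1.total hx hy
    · exact key x hx y hy
    · exact (key y hy x hx).symm
    · exact ht.total hx hy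
  have := hM.2 hc Set.subset_union_left
  refine Set.Subset.antisymm hMt fun z hz => ?_
  change (z : P) ∈ M
  rw [this]
  exact Or.inr ⟨z, hz, rfl⟩

/-- A maximal chain of `[a, c]` through `b` is cut by `b` into maximal chains of `[a, b]` and `[b,
c]` that share only `b`; counting elements gives `(k + 1) + 1 = (m + 1) + (n + 1)`. -/
theorem HasRank.add {P : Type*} [PartialOrder P] {a b c : P} (hab : a ≤ b) (hbc : b ≤ c)
    {m n k : ℕ} (hm : HasRank (Set.Icc a b) m) (hn : HasRank (Set.Icc b c) n)
    (hk : HasRank (Set.Icc a c) k) : k = m + n := by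
  let b' : Set.Icc a c := ⟨b, hab, hbc⟩
  obtain ⟨M, hM, hbM⟩ := hk.2.2.1 {b'} IsChain.singleton
  rw [Set.singleton_subset_iff] at hbM
  let M₁ : Set (Set.Icc (⟨a, le_rfl, hab.trans hbc⟩ : Set.Icc a c) b') := Subtype.val ⁻¹' M
  let M₂ : Set (Set.Icc b' (⟨c, hab.trans hbc, le_rfl⟩ : Set.Icc a c)) := Subtype.val ⁻¹' M
  have h₁ : IsMaxChain (· ≤ ·) M₁ := hM.preimage_Icc fun z hz hzI => by
    refine Or.inr fun w hw => hw.2.trans ((hM.1.total hbM hz).resolve_right fun h => hzI ⟨?_, h⟩)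
    exact z.2.1
  have h₂ : IsMaxChain (· ≤ ·) M₂ := hM.preimage_Icc fun z hz hzI => by
    refine Or.inl fun w hw => ((hM.1.total hz hbM).resolve_right fun h => hzI ⟨h, ?_⟩).trans hw.1
    exact z.2.2
  have e₁ := (hm.congr (iccIccIso (⟨a, le_rfl, hab.trans hbc⟩ : Set.Icc a c) b')).2.2.2 _ h₁
  have e₂ := (hn.congr (iccIccIso b' (⟨c, hab.trans hbc, le_rfl⟩ : Set.Icc a c))).2.2.2 _ h₂
  rw [← Subtype.val_injective.encard_image] at e₁ e₂
  have hu : Subtype.val '' M₁ ∪ Subtype.val '' M₂ = M := by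
    ext z
    constructor
    · rintro (⟨z, hz, rfl⟩ | ⟨z, hz, rfl⟩) <;> exact hz
    · intro hz
      exact (hM.1.total hz hbM).imp (fun h => ⟨⟨z, z.2.1, h⟩, hz, rfl⟩)
        fun h => ⟨⟨z, h, z.2.2⟩, hz, rfl⟩
  have hi : Subtype.val '' M₁ ∩ Subtype.val '' M₂ = {b'} := by
    ext z
    constructor
    · rintro ⟨⟨z, hz, rfl⟩, ⟨w, hw, he⟩⟩
      exact le_antisymm z.2.2 (he ▸ w.2.1)
    · rintro rfl
      exact ⟨⟨⟨b', hab, le_rfl⟩, hbM, rfl⟩, ⟨⟨b', le_rfl, hbc⟩, hbM, rfl⟩⟩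
  have e := Set.encard_union_add_encard_inter (Subtype.val '' M₁) (Subtype.val '' M₂)
  rw [hu, hi, e₁, e₂, hk.2.2.2 M hM, Set.encard_singleton] at e
  have : k + 1 + 1 = m + 1 + (n + 1) := by exact_mod_cast e
  omega

theorem IsGraded.hasRank_rank {P : Type*} [PartialOrder P] [OrderBot P] (hP : IsGraded P) (x : P) :
    HasRank (Set.Icc ⊥ x) (hP.rank x) :=
  (hP ⊥ x bot_le).choose_spec

/-- The rank of `z` in the interval `[a, b]` is the rank of `z` minus that of `a`. -/
theorem IsGraded.rank_interval {P : Type*} [PartialOrder P] [OrderBot P] (hP : IsGraded P)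
    {a b : P} [Fact (a ≤ b)] (z : Set.Icc a b) :
    hP.rank (z : P) = hP.rank a + (hP.interval a b).rank z :=
  HasRank.add bot_le z.2.1 (hP.hasRank_rank a)
    (((hP.interval a b).hasRank_rank z).congr (iccIccIso ⊥ z).symm) (hP.hasRank_rank z)

/-! ### Coordinate blocks -/

section Block

open InnerProductSpace

/-- The isometric embedding of `ℝᵐ` in `ℝⁿ` as the coordinates `r, …, r + m - 1`. -/
noncomputable def blockIsometry {m n r : ℕ} (h : r + m ≤ n) :
    EuclideanSpace ℝ (Fin m) →ₗᵢ[ℝ] EuclideanSpace ℝ (Fin n) :=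
  LinearMap.isometryOfInner
    { toFun := fun p => ∑ j : Fin m, p j • EuclideanSpace.single (⟨r + j, by omega⟩ : Fin n) (1 : ℝ)
      map_add' := fun p q => by simp [add_smul, Finset.sum_add_distrib]
      map_smul' := fun c p => by simp [mul_smul, Finset.smul_sum] }
    fun p q => by
      have hv := (EuclideanSpace.orthonormal_single (𝕜 := ℝ) (ι := Fin n)).comp
        (fun j : Fin m => (⟨r + j, by omega⟩ : Fin n)) fun i j hij => by
          simpa [Fin.ext_iff] using hij
      refine (hv.inner_sum p q Finset.univ).trans ?_
      simp [PiLp.inner_apply, mul_comm]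

theorem inner_blockIsometry {m n r : ℕ} (h : r + m ≤ n) (p : EuclideanSpace ℝ (Fin m))
    (v : EuclideanSpace ℝ (Fin n)) :
    ⟪blockIsometry h p, v⟫_ℝ = ∑ j : Fin m, p j * v ⟨r + j, by omega⟩ := by
  change ⟪∑ j : Fin m, p j • EuclideanSpace.single (⟨r + j, by omega⟩ : Fin n) (1 : ℝ), v⟫_ℝ = _
  simp [sum_inner, inner_smul_left, EuclideanSpace.inner_single_left]

theorem blockIsometry_apply {m n r : ℕ} (h : r + m ≤ n) (p : EuclideanSpace ℝ (Fin m))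
    (i : Fin n) : blockIsometry h p i =
      if hi : r ≤ i ∧ (i : ℕ) < r + m then p ⟨i - r, by omega⟩ else 0 := by
  have : blockIsometry h p i = ⟪blockIsometry h p, EuclideanSpace.single i 1⟫_ℝ := by
    simp [EuclideanSpace.inner_single_right]
  rw [this, inner_blockIsometry]
  split_ifs with hi
  · rw [Finset.sum_eq_single ⟨i - r, by omega⟩]
    · rw [PiLp.single_apply, if_pos (Fin.ext (by dsimp; omega)), mul_one]
    · intro j _ hj
      rw [PiLp.single_apply, if_neg, mul_zero]
      rintro rfl
      exact hj (Fin.ext (by simp))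
    · simp
  · refine Finset.sum_eq_zero fun j _ => ?_
    rw [PiLp.single_apply, if_neg, mul_zero]
    rintro rfl
    exact hi ⟨by simp, by simp⟩

theorem inner_blockIsometry_of_disjoint {m m' n r r' : ℕ} (h : r + m ≤ n) (h' : r' + m' ≤ n)
    (hd : r + m ≤ r' ∨ r' + m' ≤ r) (p : EuclideanSpace ℝ (Fin m))
    (q : EuclideanSpace ℝ (Fin m')) : ⟪blockIsometry h p, blockIsometry h' q⟫_ℝ = 0 := by
  rw [inner_blockIsometry]
  refine Finset.sum_eq_zero fun j _ => ?_
  rw [blockIsometry_apply, dif_neg (by dsimp; omega), mul_zero]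

/-- The difference of the vertices numbered `r + j` and `r` is the sum of the first `j` basis
vectors of the block starting at `r`. -/
theorem blockIsometry_orthoschemeVertex {m n r : ℕ} (h : r + m ≤ n) {j : ℕ} (hj : j ≤ m) :
    blockIsometry h (orthoschemeVertex m j) + orthoschemeVertex n r =
      orthoschemeVertex n (r + j) := by
  ext i
  rw [PiLp.add_apply, blockIsometry_apply]
  simp only [orthoschemeVertex]
  split_ifs <;> first | omega | simp

/-- The block sees vertex `s` of `ℝⁿ` as vertex `j` of `ℝᵐ`. The hypothesis allows `s` outside the
block: `j = 0` fits every `s ≤ r`, and `j = m` fits every `s ≥ r + m`. -/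
theorem inner_blockIsometry_orthoschemeVertex {m n r : ℕ} (h : r + m ≤ n) {j s : ℕ}
    (hjs : ∀ i < m, i < j ↔ r + i < s) (p : EuclideanSpace ℝ (Fin m)) :
    ⟪blockIsometry h p, orthoschemeVertex n s⟫_ℝ = ⟪p, orthoschemeVertex m j⟫_ℝ := by
  rw [inner_blockIsometry, PiLp.inner_apply]
  refine Finset.sum_congr rfl fun i _ => ?_
  simp [orthoschemeVertex, hjs i i.2, mul_comm]

end Block

/-! ### Links in orthoscheme complexes -/

theorem shape_link_orthoschemeComplex {P : Type u} [PartialOrder P] [BoundedOrder P]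
    (hP : IsGraded P) {σ : (orthoschemeComplex hP).Cell}
    (c : ((orthoschemeComplex hP).link σ).Cell) :
    ((orthoschemeComplex hP).link σ).shape c =
      faceLink (convexHull ℝ (hP.vertex '' σ.1)) (convexHull ℝ (hP.vertex '' c.1.1)) :=
  congrArg (faceLink · (convexHull ℝ (hP.vertex '' c.1.1))) (Set.image_id _)

/-- The intervals `[a i, b i]` decompose the chains of a poset that contain the chain `σ`: any two
of them are separated by elements of `σ`, the elements of `σ` are not in their interiors, and they
contain all elements that are comparable to `σ`. -/
structure IsIntervalDecomposition {P ι : Type*} [PartialOrder P] (a b : ι → P) (σ : Set P) :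
    Prop where
  le_or_le : ∀ i, ∀ y ∈ σ, (y ≤ a i ∧ a i ∈ σ) ∨ (b i ≤ y ∧ b i ∈ σ)
  separated : ∀ i j, i ≠ j → (b i ≤ a j ∧ b i ∈ σ) ∨ (b j ≤ a i ∧ a i ∈ σ)
  cover : ∀ z, (∀ y ∈ σ, y ≤ z ∨ z ≤ y) → ∃ i, z ∈ Set.Icc (a i) (b i)

/-! ### Chains through `σ` as families of chains in the intervals -/

section Decomposition

variable {P : Type u} [PartialOrder P] {ι : Type} {a b : ι → P} {σ : Set P}

/-- Separated intervals meet at most in a common endpoint, and `separated` puts that endpoint in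
`σ`. -/
theorem IsIntervalDecomposition.mem_of_ne (hd : IsIntervalDecomposition a b σ) {i j : ι}
    (hij : i ≠ j) {z : P} (hi : z ∈ Set.Icc (a i) (b i)) (hj : z ∈ Set.Icc (a j) (b j)) :
    z ∈ σ := by
  rcases hd.separated i j hij with ⟨h, hm⟩ | ⟨h, hm⟩
  · exact le_antisymm hi.2 (h.trans hj.1) ▸ hm
  · exact le_antisymm hi.1 (hj.2.trans h) ▸ hm

/-- Any element of `σ` forces an endpoint of the interval into `σ`. This is needed because cells are
nonempty chains. -/
theorem IsIntervalDecomposition.preimage_nonempty (hd : IsIntervalDecomposition a b σ)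
    (hσ : σ.Nonempty) (i : ι) (hi : a i ≤ b i) :
    (Subtype.val ⁻¹' σ : Set (Set.Icc (a i) (b i))).Nonempty := by
  obtain ⟨y, hy⟩ := hσ
  rcases hd.le_or_le i y hy with ⟨-, h⟩ | ⟨-, h⟩
  exacts [⟨⟨a i, le_rfl, hi⟩, h⟩, ⟨⟨b i, hi, le_rfl⟩, h⟩]

theorem IsIntervalDecomposition.iUnion_image_preimage (hd : IsIntervalDecomposition a b σ)
    {s : Set P} (hs : IsChain (· ≤ ·) s) (hσs : σ ⊆ s) :
    ⋃ i, Subtype.val '' (Subtype.val ⁻¹' s : Set (Set.Icc (a i) (b i))) = s := by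
  ext z
  simp only [Set.mem_iUnion]
  constructor
  · rintro ⟨i, z, hz, rfl⟩
    exact hz
  · intro hz
    obtain ⟨i, hi⟩ := hd.cover z fun y hy => hs.total (hσs hy) hz
    exact ⟨i, ⟨z, hi⟩, hz, rfl⟩

/-- Whatever the other pieces contribute to the `i`-th interval lies in `σ`, hence already in `c i`.
-/
theorem IsIntervalDecomposition.preimage_iUnion_image (hd : IsIntervalDecomposition a b σ)
    {c : ∀ i, Set (Set.Icc (a i) (b i))} (hc : ∀ i, Subtype.val ⁻¹' σ ⊆ c i) (i : ι) :
    Subtype.val ⁻¹' (⋃ j, Subtype.val '' c j : Set P) = c i := by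
  ext z
  simp only [Set.mem_preimage, Set.mem_iUnion]
  constructor
  · rintro ⟨j, w, hw, he⟩
    by_cases hij : i = j
    · subst hij
      exact Subtype.ext he ▸ hw
    · exact hc i (hd.mem_of_ne hij z.2 (he ▸ w.2))
  · exact fun hz => ⟨i, z, hz, rfl⟩

theorem IsIntervalDecomposition.subset_iUnion_image (hd : IsIntervalDecomposition a b σ)
    (hσ : IsChain (· ≤ ·) σ) {c : ∀ i, Set (Set.Icc (a i) (b i))}
    (hc : ∀ i, Subtype.val ⁻¹' σ ⊆ c i) : σ ⊆ ⋃ i, Subtype.val '' c i := by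
  nth_rw 1 [← hd.iUnion_image_preimage hσ subset_rfl]
  exact Set.iUnion_mono fun i => Set.image_mono (hc i)

theorem IsIntervalDecomposition.isChain_iUnion_image (hd : IsIntervalDecomposition a b σ)
    {c : ∀ i, Set (Set.Icc (a i) (b i))} (hc : ∀ i, IsChain (· ≤ ·) (c i)) :
    IsChain (· ≤ ·) (⋃ i, Subtype.val '' c i : Set P) := by
  intro z' hz' w' hw' _
  obtain ⟨i, z, hz, rfl⟩ := Set.mem_iUnion.1 hz'
  obtain ⟨j, w, hw, rfl⟩ := Set.mem_iUnion.1 hw'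
  by_cases hij : i = j
  · subst hij
    exact (hc i).total hz hw
  · exact (hd.separated i j hij).imp (fun h => z.2.2.trans (h.1.trans w.2.1))
      fun h => w.2.2.trans (h.1.trans z.2.1)

end Decomposition

/-! ### The link of a chain and the join over an interval decomposition -/

section LinkJoin

variable {P : Type u} [PartialOrder P] [BoundedOrder P] (hP : IsGraded P)
  {ι : Type} {a b : ι → P} [∀ i, Fact (a i ≤ b i)] {σ : (orthoschemeComplex hP).Cell}
  {τ : ∀ i, (orthoschemeComplex (hP.interval (a i) (b i))).Cell}

theorem IsGraded.rank_add_rank_top_le (i : ι) :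
    hP.rank (a i) + (hP.interval (a i) (b i)).rank ⊤ ≤ hP.rank ⊤ := by
  rw [← hP.rank_interval]
  exact hP.rank_strictMono.monotone le_top

/-- The block of `[a i, b i]` ends at the rank of `b i`, so separated intervals occupy disjoint sets
of coordinates. -/
theorem IsGraded.orthogonalFamily_blockIsometry (hd : IsIntervalDecomposition a b σ.1) :
    OrthogonalFamily ℝ (fun i => EuclideanSpace ℝ (Fin ((hP.interval (a i) (b i)).rank ⊤)))
      fun i => blockIsometry (hP.rank_add_rank_top_le (a := a) (b := b) i) := by
  intro i j hij p q
  refine inner_blockIsometry_of_disjoint _ _ ?_ p q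
  rw [← hP.rank_interval, ← hP.rank_interval]
  exact (hd.separated i j hij).imp (fun h => hP.rank_strictMono.monotone h.1)
    fun h => hP.rank_strictMono.monotone h.1

theorem IsGraded.blockIsometry_vertex (i : ι) (z : Set.Icc (a i) (b i)) :
    blockIsometry (hP.rank_add_rank_top_le (a := a) (b := b) i)
      ((hP.interval (a i) (b i)).vertex z) + hP.vertex (a i) = hP.vertex z := by
  rw [IsGraded.vertex, IsGraded.vertex, blockIsometry_orthoschemeVertex _
    ((hP.interval (a i) (b i)).rank_strictMono.monotone le_top), ← hP.rank_interval]
  rfl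

/-- An element of `σ` is below `a i` or above `b i`, so its coordinates in the block are all `0` or
all `1`: those of the bottom or top of the interval. This supplies `hadj` in
`faceLink_eq_image_joinShape`. -/
theorem IsGraded.exists_inner_blockIsometry_vertex (hd : IsIntervalDecomposition a b σ.1) (i : ι)
    {y : P} (hy : y ∈ σ.1) : ∃ z : Set.Icc (a i) (b i), (z : P) ∈ σ.1 ∧ ∀ p,
      inner ℝ (blockIsometry (hP.rank_add_rank_top_le (a := a) (b := b) i) p) (hP.vertex y) =
        inner ℝ p ((hP.interval (a i) (b i)).vertex z) := by
  rcases hd.le_or_le i y hy with ⟨h, hm⟩ | ⟨h, hm⟩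
  · refine ⟨⊥, hm, inner_blockIsometry_orthoschemeVertex _ fun j _ => ?_⟩
    have h1 := hP.rank_interval (⊥ : Set.Icc (a i) (b i))
    have h2 := hP.rank_strictMono.monotone h
    rw [Set.Icc.coe_bot] at h1
    omega
  · refine ⟨⊤, hm, inner_blockIsometry_orthoschemeVertex _ fun j _ => ?_⟩
    have h1 := hP.rank_interval (⊤ : Set.Icc (a i) (b i))
    have h2 := hP.rank_strictMono.monotone h
    rw [Set.Icc.coe_top] at h1
    omega

variable [Fintype ι]

/-- The cells of the link of `σ` correspond to families of cells of the links in the intervals. -/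
def linkCellEquiv (hd : IsIntervalDecomposition a b σ.1)
    (hτ : ∀ i, (τ i).1 = Subtype.val ⁻¹' σ.1) :
    ((orthoschemeComplex hP).link σ).Cell ≃o
      (sphericalJoin fun i => (orthoschemeComplex (hP.interval (a i) (b i))).link (τ i)).Cell where
  toFun s i := ⟨⟨Subtype.val ⁻¹' s.1.1, s.1.2.1.preimage Subtype.val_injective.injOn,
    (hd.preimage_nonempty σ.2.2.1 i Fact.out).mono (Set.preimage_mono s.2),
    fun x hx y hy hxy => s.1.2.2.2 hx hy fun h => hxy (Subtype.ext h)⟩,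
    (hτ i).trans_subset (Set.preimage_mono s.2)⟩
  invFun c :=
    have hc := hd.subset_iUnion_image σ.2.2.2 fun i => (hτ i).symm.trans_subset (c i).2
    ⟨⟨⋃ i, Subtype.val '' (c i).1.1, Set.finite_iUnion fun i => (c i).1.2.1.image _,
      σ.2.2.1.mono hc, hd.isChain_iUnion_image fun i => (c i).1.2.2.2⟩, hc⟩
  left_inv s := Subtype.ext (Subtype.ext (hd.iUnion_image_preimage s.1.2.2.2 s.2))
  right_inv c := funext fun i => Subtype.ext (Subtype.ext
    (hd.preimage_iUnion_image (fun i => (hτ i).symm.trans_subset (c i).2) i))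
  map_rel_iff' {s t} := by
    -- Inclusion of all traces gives inclusion of the chains, since each chain is the union of its
    -- traces.
    refine ⟨fun h => ?_, fun h i => Set.preimage_mono h⟩
    change s.1.1 ⊆ t.1.1
    rw [← hd.iUnion_image_preimage s.1.2.2.2 s.2, ← hd.iUnion_image_preimage t.1.2.2.2 t.2]
    exact Set.iUnion_mono fun i => Set.image_mono (h i)

theorem image_joinShape_linkCellEquiv (hd : IsIntervalDecomposition a b σ.1)
    (hτ : ∀ i, (τ i).1 = Subtype.val ⁻¹' σ.1) (c : ((orthoschemeComplex hP).link σ).Cell) :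
    (hP.orthogonalFamily_blockIsometry hd).piLpIsometry ''
        (sphericalJoin fun i => (orthoschemeComplex (hP.interval (a i) (b i))).link (τ i)).shape
          (linkCellEquiv hP hd hτ c) =
      ((orthoschemeComplex hP).link σ).shape c := by
  rw [shape_link_orthoschemeComplex]
  refine Eq.trans (congrArg _ (congrArg (joinShape
    (E := fun i => EuclideanSpace ℝ (Fin ((hP.interval (a i) (b i)).rank ⊤)))) (funext fun i =>
      shape_link_orthoschemeComplex (hP.interval (a i) (b i)) (linkCellEquiv hP hd hτ c i)))) ?_
  -- The translation is by the vertex of `a i`, since the bottom of the interval sits at the origin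
  -- of its own orthoscheme.
  refine faceLink_eq_image_joinShape _ (fun i => hP.vertex (a i)) (Set.image_mono c.2)
    (σ.2.2.1.image _) (fun i => Set.image_mono (linkCellEquiv hP hd hτ c i).2)
    (fun i => (τ i).2.2.1.image _) ?_ ?_ ?_ ?_
  · rintro i _ ⟨z, hz, rfl⟩
    rw [hP.blockIsometry_vertex]
    exact ⟨z, hz, rfl⟩
  · rintro i _ ⟨z, hz, rfl⟩
    rw [hP.blockIsometry_vertex]
    rw [hτ i] at hz
    exact ⟨z, hz, rfl⟩
  · rintro _ ⟨y, hy, rfl⟩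
    obtain ⟨i, hi⟩ := hd.cover y fun w hw => c.1.2.2.2.total (c.2 hw) hy
    exact ⟨i, _, ⟨⟨y, hi⟩, hy, rfl⟩, hP.blockIsometry_vertex i ⟨y, hi⟩⟩
  · rintro i _ ⟨y, hy, rfl⟩
    obtain ⟨z, hz, h⟩ := hP.exists_inner_blockIsometry_vertex hd i hy
    exact ⟨_, ⟨z, by rw [hτ i]; exact hz, rfl⟩, h⟩

/-- The link of a chain is the spherical join of the links in the intervals of a decomposition. -/
noncomputable def linkIsoSphericalJoin (hd : IsIntervalDecomposition a b σ.1)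
    (hτ : ∀ i, (τ i).1 = Subtype.val ⁻¹' σ.1) :
    PSComplex.Iso ((orthoschemeComplex hP).link σ)
      (sphericalJoin fun i => (orthoschemeComplex (hP.interval (a i) (b i))).link (τ i)) :=
  -- The isometry is the same for every cell and all gluing maps are identities, so compatibility
  -- holds by `rfl`.
  PSComplex.isoOfLinearIsometry (linkCellEquiv hP hd hτ)
    (fun _ => (hP.orthogonalFamily_blockIsometry hd).piLpIsometry)
    (image_joinShape_linkCellEquiv hP hd hτ) fun _ _ => rfl

end LinkJoin

/-! ### The decomposition cut out by the chain itself -/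

theorem isIntervalDecomposition_range {P : Type*} [PartialOrder P] [BoundedOrder P] {k : ℕ}
    {x : Fin (k + 1) → P} (hx : StrictMono x) :
    IsIntervalDecomposition
      (Sum.elim (fun _ : Unit => ⊥)
        (Sum.elim (fun i : Fin k => x i.castSucc) fun _ : Unit => x (Fin.last k)))
      (Sum.elim (fun _ : Unit => x 0)
        (Sum.elim (fun i : Fin k => x i.succ) fun _ : Unit => ⊤))
      (Set.range x) where
  le_or_le := by
    rintro (_ | i | _) _ ⟨j, rfl⟩
    · exact Or.inr ⟨hx.monotone (Fin.zero_le j), 0, rfl⟩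
    · rcases le_or_gt j i.castSucc with h | h
      · exact Or.inl ⟨hx.monotone h, _, rfl⟩
      · exact Or.inr ⟨hx.monotone (Fin.castSucc_lt_iff_succ_le.1 h), _, rfl⟩
    · exact Or.inl ⟨hx.monotone (Fin.le_last j), _, rfl⟩
  separated := by
    rintro (_ | i | _) (_ | j | _) hij
    · exact absurd rfl hij
    · exact Or.inl ⟨hx.monotone (Fin.zero_le _), _, rfl⟩
    · exact Or.inl ⟨hx.monotone (Fin.zero_le _), _, rfl⟩
    · exact Or.inr ⟨hx.monotone (Fin.zero_le _), _, rfl⟩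
    · have hij : i ≠ j := fun h => hij (h ▸ rfl)
      rcases lt_or_gt_of_ne hij with h | h
      · exact Or.inl ⟨hx.monotone (Fin.succ_le_castSucc_iff.2 h), _, rfl⟩
      · exact Or.inr ⟨hx.monotone (Fin.succ_le_castSucc_iff.2 h), _, rfl⟩
    · exact Or.inl ⟨hx.monotone (Fin.le_last _), _, rfl⟩
    · exact Or.inr ⟨hx.monotone (Fin.zero_le _), _, rfl⟩
    · exact Or.inr ⟨hx.monotone (Fin.le_last _), _, rfl⟩
    · exact absurd rfl hij
  cover := by
    intro z hz
    by_cases h0 : z ≤ x 0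
    · exact ⟨Sum.inl (), bot_le, h0⟩
    by_cases hlast : x (Fin.last k) ≤ z
    · exact ⟨Sum.inr (Sum.inr ()), hlast, le_top⟩
    -- The chain starts below `z` and does not stay below it; without such a jump, induction would
    -- give `x (Fin.last k) ≤ z`.
    have h : ∃ i : Fin k, x i.castSucc ≤ z ∧ ¬ x i.succ ≤ z := by
      by_contra! h
      exact hlast (Fin.induction ((hz _ ⟨0, rfl⟩).resolve_right h0) h (Fin.last k))
    obtain ⟨i, hi, hi'⟩ := h
    exact ⟨Sum.inr (Sum.inl i), hi, (hz _ ⟨_, rfl⟩).resolve_left hi'⟩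

theorem mainTheorem10 {P : Type u} [PartialOrder P] [BoundedOrder P] (hP : IsGraded P)
    (k : ℕ) (x : Fin (k + 1) → P) (hx : StrictMono x) :
    Nonempty (PSComplex.Iso
      ((orthoschemeComplex hP).link (chainSimplex hP x hx))
      (sphericalJoin
        (Sum.elim (fun _ : Unit => hP.upperEndpointLink (bot_le : ⊥ ≤ x 0))
          (Sum.elim (fun i : Fin k => hP.diagonalLink (hx i.castSucc_lt_succ))
            (fun _ : Unit => hP.lowerEndpointLink (le_top : x (Fin.last k) ≤ ⊤)))))) := by
  let a : Unit ⊕ Fin k ⊕ Unit → P := Sum.elim (fun _ => ⊥)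
    (Sum.elim (fun i => x i.castSucc) fun _ => x (Fin.last k))
  let b : Unit ⊕ Fin k ⊕ Unit → P := Sum.elim (fun _ => x 0)
    (Sum.elim (fun i => x i.succ) fun _ => ⊤)
  have hd : IsIntervalDecomposition a b (Set.range x) := isIntervalDecomposition_range hx
  have hab : ∀ i, a i ≤ b i := by
    rintro (_ | i | _)
    exacts [bot_le, (hx i.castSucc_lt_succ).le, le_top]
  have : ∀ i, Fact (a i ≤ b i) := fun i => ⟨hab i⟩
  -- The trace of the chain on each interval is exactly the vertex or edge used in the local link.
  -- The `Sum.elim` family reduces only once the index is split, so the cell and the equality of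
  -- complexes are produced together; the final `rfl` in each case determines the cell.
  have hK : ∀ i, ∃ τ : (orthoschemeComplex (hP.interval (a i) (b i))).Cell,
      τ.1 = Subtype.val ⁻¹' Set.range x ∧
      Sum.elim (fun _ : Unit => hP.upperEndpointLink (bot_le : ⊥ ≤ x 0))
        (Sum.elim (fun i : Fin k => hP.diagonalLink (hx i.castSucc_lt_succ))
          (fun _ : Unit => hP.lowerEndpointLink (le_top : x (Fin.last k) ≤ ⊤))) i =
        (orthoschemeComplex (hP.interval (a i) (b i))).link τ := by
    rintro (_ | i | _)
    · refine ⟨_, ?_, rfl⟩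
      ext z
      constructor
      · rintro rfl
        exact ⟨0, rfl⟩
      · rintro ⟨j, hj⟩
        exact Subtype.ext (le_antisymm z.2.2 (hj ▸ hx.monotone (Fin.zero_le j)))
    · refine ⟨_, ?_, rfl⟩
      ext z
      constructor
      · rintro (rfl | rfl)
        exacts [⟨_, rfl⟩, ⟨_, rfl⟩]
      · rintro ⟨j, hj⟩
        rcases le_or_gt j i.castSucc with h | h
        · exact Or.inl (Subtype.ext (le_antisymm (hj ▸ hx.monotone h) z.2.1))
        · exact Or.inr (Subtype.ext (le_antisymm z.2.2
            (hj ▸ hx.monotone (Fin.castSucc_lt_iff_succ_le.1 h))))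
    · refine ⟨_, ?_, rfl⟩
      ext z
      constructor
      · rintro rfl
        exact ⟨_, rfl⟩
      · rintro ⟨j, hj⟩
        exact Subtype.ext (le_antisymm (hj ▸ hx.monotone (Fin.le_last j)) z.2.1)
  choose τ hτ hK using hK
  rw [funext hK]
  exact ⟨linkIsoSphericalJoin hP (σ := chainSimplex hP x hx) hd hτ⟩
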